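/- Let $M$ be a smooth (Hausdorff, second countable) manifold of dimension $2n+1$, $n\ge 0$. An almost contact metric structure $(\phi,\xi,\eta,g)$ on $M$ consists of a smooth $(1,1)$-tensor field $\phi$, a smooth vector field $\xi$, a smooth $1$-form $\eta$ and a Riemannian metric $g$ such that, for all vector fields $X,Y$, $$\phi^2X=-X+\eta(X)\xi,\quad \phi\xi=0,\quad \eta\circ\phi=0,\quad \eta(\xi)=1,\quad g(\phi X,\phi Y)=g(X,Y)-\eta(X)\eta(Y),\quad \eta(X)=g(\xi,X).$$ It is a contact metric structure if $\eta\wedge(d\eta)^n\neq0$ everywhere and $d\eta(X,Y)=g(X,\phi Y)$, where $d\eta(X,Y)=\tfrac12\big(X\eta(Y)-Y\eta(X)-\eta([X,Y])\big)$. It is normal if the almost complex structure $\bar J$ on $M\times\mathbb R$ given by $\bar JX=\phi X-\eta(X)\frac{\partial}{\partial t}$, $\bar J\frac{\partial}{\partial t}=\xi$ is integrable, i.e. its Nijenhuis torsion vanishes, and it is Sasakian if it is a normal contact metric structure. Let $\nabla$ be the Levi-Civita connection of $g$, $R(X,Y)Z=[\nabla_X,\nabla_Y]Z-\nabla_{[X,Y]}Z$,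 $R(X,Y,Z,W)=g(R(X,Y)Z,W)$, and $\Phi(X,Y)=g(\phi X,Y)$. Consider the following identities, each required for all smooth vector fields $X,Y,Z,W$ on $M$: $$(G_1)\quad R(X,Y,Z,W)-R(X,Y,\phi Z,\phi W)=g(X,W)g(Y,Z)-g(Y,W)g(X,Z)-\Phi(X,W)\Phi(Y,Z)+\Phi(Y,W)\Phi(X,Z);$$ $$(G_2)\quad R(X,Y,Z,W)-R(\phi X,\phi Y,Z,W)-R(\phi X,Y,\phi Z,W)-R(\phi X,Y,Z,\phi W)=g(Y,Z)\eta(X)\eta(W)-g(Y,W)\eta(X)\eta(Z);$$ $$(G_3)\quad R(X,Y,Z,W)-R(\phi X,\phi Y,\phi Z,\phi W)=g(X,W)\eta(Y)\eta(Z)+g(Y,Z)\eta(X)\eta(W)-g(X,Z)\eta(Y)\eta(W)-g(Y,W)\eta(X)\eta(Z).$$ If $(\phi,\xi,\eta,g)$ is a contact metric structure on $M$ that satisfies at least one of $(G_1)$, $(G_2)$, $(G_3)$, then it is Sasakian. -/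

import Mathlib

open Set Bundle VectorField
open scoped Manifold ContDiff

noncomputable section

namespace ContactGeometry

/-! ### Vector fields on a manifold -/

section General

variable {E : Type*} [NormedAddCommGroup E] [NormedSpace ℝ E]
  {H : Type*} [TopologicalSpace H] (I : ModelWithCorners ℝ E H)
  {M : Type*} [TopologicalSpace M] [ChartedSpace H M] [IsManifold I ∞ M]

/-- `X` is a smooth vector field on `M`. -/
def IsSmoothField (X : ∀ x : M, TangentSpace I x) : Prop :=
  ContMDiff I I.tangent ∞ (fun x ↦ (⟨x, X x⟩ : TangentBundle I M))

/-- The Nijenhuis torsion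
`[J, J](X, Y) = J²[X, Y] + [JX, JY] - J[JX, Y] - J[X, JY]` of a `(1,1)`-tensor field `J`. -/
def nijenhuis (J : ∀ x : M, TangentSpace I x →L[ℝ] TangentSpace I x)
    (X Y : ∀ x : M, TangentSpace I x) (x : M) : TangentSpace I x :=
  J x (J x (mlieBracket I X Y x))
    + mlieBracket I (fun y ↦ J y (X y)) (fun y ↦ J y (Y y)) x
    - J x (mlieBracket I (fun y ↦ J y (X y)) Y x)
    - J x (mlieBracket I X (fun y ↦ J y (Y y)) x)

/-- An almost complex structure `J` is integrable: its Nijenhuis torsion vanishes. -/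
def IsIntegrable (J : ∀ x : M, TangentSpace I x →L[ℝ] TangentSpace I x) : Prop :=
  ∀ X Y : ∀ x : M, TangentSpace I x, IsSmoothField I X → IsSmoothField I Y →
    ∀ x, nijenhuis I J X Y x = 0

/-- The exterior derivative of a 1-form, with the normalization
`2 dη(X, Y) = X(η(Y)) - Y(η(X)) - η([X, Y])` used in contact metric geometry. -/
def dForm (η : ∀ x : M, TangentSpace I x →L[ℝ] ℝ)
    (X Y : ∀ x : M, TangentSpace I x) (x : M) : ℝ :=
  (1 / 2 : ℝ) * (mvfderiv I (fun y ↦ η y (Y y)) x (X x)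
    - mvfderiv I (fun y ↦ η y (X y)) x (Y x)
    - η x (mlieBracket I X Y x))

end General

/-! ### The Levi-Civita connection and the curvature tensor -/

section Riemannian

variable {E : Type*} [NormedAddCommGroup E] [NormedSpace ℝ E] [FiniteDimensional ℝ E]
  {H : Type*} [TopologicalSpace H] {I : ModelWithCorners ℝ E H}
  {M : Type*} [TopologicalSpace M] [ChartedSpace H M] [IsManifold I ∞ M]
  (g : ContMDiffRiemannianMetric I ∞ E (fun x : M ↦ TangentSpace I x))

/-- The right-hand side of the Koszul formula for `2 g(∇_X Y, Z)`. -/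
def koszul (X Y Z : ∀ x : M, TangentSpace I x) (x : M) : ℝ :=
  mvfderiv I (fun y ↦ g.inner y (Y y) (Z y)) x (X x)
    + mvfderiv I (fun y ↦ g.inner y (Z y) (X y)) x (Y x)
    - mvfderiv I (fun y ↦ g.inner y (X y) (Y y)) x (Z x)
    + g.inner x (mlieBracket I X Y x) (Z x)
    - g.inner x (mlieBracket I Y Z x) (X x)
    + g.inner x (mlieBracket I Z X x) (Y x)

/-- `v` satisfies the Koszul formula for `∇_X Y` at `x`, tested against all vector fields that are
differentiable at `x`. -/
def IsKoszulVector (X Y : ∀ x : M, TangentSpace I x) (x : M) (v : TangentSpace I x) : Prop :=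
  ∀ Z : ∀ x : M, TangentSpace I x,
    MDifferentiableAt I I.tangent (fun y ↦ (⟨y, Z y⟩ : TangentBundle I M)) x →
      2 * g.inner x v (Z x) = koszul g X Y Z x

theorem mdiff_inner {X Y : ∀ x : M, TangentSpace I x} {x : M} (hX : MDiffAt (T% X) x)
    (hY : MDiffAt (T% Y) x) : MDiffAt (fun y ↦ g.inner y (X y) (Y y)) x := by
  let : RiemannianBundle (fun x : M ↦ TangentSpace I x) := ⟨g.toRiemannianMetric⟩
  have : IsContMDiffRiemannianBundle I 1 E (fun x : M ↦ TangentSpace I x) :=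
    .of_le (n := ∞) (by simp)
  exact MDifferentiableAt.inner_bundle (IB := I) (F := E) (E := fun x : M ↦ TangentSpace I x) hX hY

theorem koszul_tensorial {X Y : ∀ x : M, TangentSpace I x} {x : M} (hX : MDiffAt (T% X) x)
    (hY : MDiffAt (T% Y) x) :
    TensorialAt I E (fun Z ↦ koszul g X Y Z x) x where
  smul := by
    intro f Z hf hZ
    have : IsManifold I 2 M := inferInstance
    have e1 : (fun y ↦ g.inner y (Y y) ((f • Z) y)) = f * (fun y ↦ g.inner y (Y y) (Z y)) := by
      ext y; simp
    have e2 : (fun y ↦ g.inner y ((f • Z) y) (X y)) = f * (fun y ↦ g.inner y (Z y) (X y)) := by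
      ext y; simp
    simp only [koszul, e1, e2]
    rw [mvfderiv_mul hf (mdiff_inner g hY hZ), mvfderiv_mul hf (mdiff_inner g hZ hX),
      mlieBracket_smul_right hf hZ, mlieBracket_smul_left hf hZ]
    simp [g.symm x (Y x) (Z x)]
    ring
  add := by
    intro Z Z' hZ hZ'
    have : IsManifold I 2 M := inferInstance
    have e1 : (fun y ↦ g.inner y (Y y) ((Z + Z') y)) = (fun y ↦ g.inner y (Y y) (Z y)) + (fun y ↦ g.inner y (Y y) (Z' y)) := by
      ext y; simp
    have e2 : (fun y ↦ g.inner y ((Z + Z') y) (X y)) = (fun y ↦ g.inner y (Z y) (X y)) + (fun y ↦ g.inner y (Z' y) (X y)):= by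
      ext y; simp
    simp only [koszul, e1, e2]
    rw [mvfderiv_add (mdiff_inner g hY hZ) (mdiff_inner g hY hZ'), mvfderiv_add (mdiff_inner g hZ hX) (mdiff_inner g hZ' hX),
      mlieBracket_add_right hZ hZ', mlieBracket_add_left hZ hZ']
    simp
    ring

/-- The Koszul formula determines a vector: the connection below is well defined. -/
theorem exists_koszulVector {X Y : ∀ x : M, TangentSpace I x} {x : M} (hX : MDiffAt (T% X) x)
    (hY : MDiffAt (T% Y) x) : ∃ v : TangentSpace I x, IsKoszulVector g X Y x v := by
  have : IsManifold I 1 M := inferInstance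
  have : FiniteDimensional ℝ (TangentSpace I x) := inferInstanceAs (FiniteDimensional ℝ E)
  let ℓ := TensorialAt.mkHom _ x (koszul_tensorial g hX hY)
  let B : TangentSpace I x →ₗ[ℝ] Module.Dual ℝ (TangentSpace I x) :=
    { toFun := fun v ↦ (g.inner x v).toLinearMap
      map_add' := by intros; ext; simp
      map_smul' := by intros; ext; simp }
  have hB : Function.Injective B := by
    rw [injective_iff_map_eq_zero]
    intro v hv
    by_contra hne
    have h1 := g.pos x v hne
    have h2 : g.inner x v v = 0 := congrArg (fun L ↦ L v) hv
    linarith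
  have hs : Function.Surjective B :=
    (LinearMap.injective_iff_surjective_of_finrank_eq_finrank
      (Subspace.dual_finrank_eq).symm).1 hB
  obtain ⟨v, hv⟩ := hs ((1 / 2 : ℝ) • ℓ.toLinearMap)
  refine ⟨v, fun Z hZ ↦ ?_⟩
  have h1 : g.inner x v (Z x) = (1 / 2 : ℝ) * ℓ (Z x) := congrArg (fun L ↦ L (Z x)) hv
  have h2 : ℓ (Z x) = koszul g X Y Z x := TensorialAt.mkHom_apply (koszul_tensorial g hX hY) hZ
  rw [h1, h2]; ring

open Classical in
/-- The Levi-Civita connection `∇_X Y` of `g`, given by the Koszul formula. -/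
def leviCivita (X Y : ∀ x : M, TangentSpace I x) (x : M) : TangentSpace I x :=
  if h : ∃ v : TangentSpace I x, IsKoszulVector g X Y x v then h.choose else 0

theorem leviCivita_spec {X Y : ∀ x : M, TangentSpace I x} {x : M} (hX : MDiffAt (T% X) x)
    (hY : MDiffAt (T% Y) x) : IsKoszulVector g X Y x (leviCivita g X Y x) := by
  have h := exists_koszulVector g hX hY
  rw [leviCivita, dif_pos h]
  exact h.choose_spec

/-- The connection is metric. -/
theorem leviCivita_metric {X Y Z : ∀ x : M, TangentSpace I x} {x : M} (hX : MDiffAt (T% X) x)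
    (hY : MDiffAt (T% Y) x) (hZ : MDiffAt (T% Z) x) :
    mvfderiv I (fun y ↦ g.inner y (Y y) (Z y)) x (X x)
      = g.inner x (leviCivita g X Y x) (Z x) + g.inner x (Y x) (leviCivita g X Z x) := by
  have h1 := leviCivita_spec g hX hY Z hZ
  have h2 := leviCivita_spec g hX hZ Y hY
  rw [g.symm x (Y x)]
  have e (A B : ∀ x : M, TangentSpace I x) :
    (fun y ↦ g.inner y (A y) (B y)) = fun y ↦ g.inner y (B y) (A y) := by
      ext y; exact g.symm _ _ _
  rw [koszul] at h1 h2
  rw [e Z Y, e Y X, mlieBracket_swap_apply (V := X) (W := Z), mlieBracket_swap_apply (V := Z) (W := Y),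
    mlieBracket_swap_apply (V := Y) (W := X), e X Z] at h2
  simp only [map_neg, neg_apply] at h2
  linarith

/-- The connection is torsion-free. -/
theorem leviCivita_torsion_free {X Y : ∀ x : M, TangentSpace I x} {x : M}
    (hX : MDiffAt (T% X) x) (hY : MDiffAt (T% Y) x) :
    leviCivita g X Y x - leviCivita g Y X x = mlieBracket I X Y x := by
  have : IsManifold I 1 M := inferInstance
  have key : ∀ w : TangentSpace I x,
      g.inner x (leviCivita g X Y x - leviCivita g Y X x - mlieBracket I X Y x) w = 0 := by
    intro w
    have hZ := FiberBundle.mdifferentiableAt_extend I E (V := fun x : M ↦ TangentSpace I x) w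
    have h1 := leviCivita_spec g hX hY _ hZ
    have h2 := leviCivita_spec g hY hX _ hZ
    have hw : FiberBundle.extend E (E := fun x : M ↦ TangentSpace I x) w x = w := by simp
    set Z := FiberBundle.extend E (E := fun x : M ↦ TangentSpace I x) w
    have e (A B : ∀ x : M, TangentSpace I x) :
      (fun y ↦ g.inner y (A y) (B y)) = fun y ↦ g.inner y (B y) (A y) := by
        ext y; exact g.symm _ _ _
    rw [koszul] at h1 h2
    rw [e X Z, e Z Y, e Y X, mlieBracket_swap_apply (V := X) (W := Z), mlieBracket_swap_apply (V := Z) (W := Y),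
      mlieBracket_swap_apply (V := Y) (W := X)] at h2
    simp only [map_neg, neg_apply, hw] at h1 h2
    simp only [map_sub, sub_apply]
    linarith
  by_contra hne
  exact (g.pos x _ (sub_ne_zero.2 hne)).ne' (key _)
/-- `R(X, Y)Z = ∇_X ∇_Y Z - ∇_Y ∇_X Z - ∇_{[X, Y]} Z`. -/
def curvature (X Y Z : ∀ x : M, TangentSpace I x) (x : M) : TangentSpace I x :=
  leviCivita g X (leviCivita g Y Z) x - leviCivita g Y (leviCivita g X Z) x
    - leviCivita g (mlieBracket I X Y) Z x

/-- `R(X, Y, Z, W) = g(R(X, Y)Z, W)`. -/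
def curvature₄ (X Y Z W : ∀ x : M, TangentSpace I x) (x : M) : ℝ :=
  g.inner x (curvature g X Y Z x) (W x)

end Riemannian

/-! ### Almost contact metric structures -/

/-- An almost contact metric structure `(φ, ξ, η, g)` on a smooth manifold of dimension `2n+1`. -/
structure AlmostContactMetric (n : ℕ) (M : Type*) [TopologicalSpace M]
    [ChartedSpace (EuclideanSpace ℝ (Fin (2 * n + 1))) M] [IsManifold (𝓡 (2 * n + 1)) ∞ M] where
  /-- the `(1,1)`-tensor field `φ` -/
  φ : ∀ x : M, TangentSpace (𝓡 (2 * n + 1)) x →L[ℝ] TangentSpace (𝓡 (2 * n + 1)) x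
  /-- the vector field `ξ` -/
  ξ : ∀ x : M, TangentSpace (𝓡 (2 * n + 1)) x
  /-- the 1-form `η` -/
  η : ∀ x : M, TangentSpace (𝓡 (2 * n + 1)) x →L[ℝ] ℝ
  /-- the Riemannian metric `g` -/
  g : ContMDiffRiemannianMetric (𝓡 (2 * n + 1)) ∞ (EuclideanSpace ℝ (Fin (2 * n + 1)))
    (fun x : M ↦ TangentSpace (𝓡 (2 * n + 1)) x)
  smooth_φ : ContMDiff (𝓡 (2 * n + 1)) ((𝓡 (2 * n + 1)).prod
      𝓘(ℝ, EuclideanSpace ℝ (Fin (2 * n + 1)) →L[ℝ] EuclideanSpace ℝ (Fin (2 * n + 1)))) ∞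
    (fun x : M ↦ TotalSpace.mk'
      (EuclideanSpace ℝ (Fin (2 * n + 1)) →L[ℝ] EuclideanSpace ℝ (Fin (2 * n + 1)))
      (E := fun x : M ↦ TangentSpace (𝓡 (2 * n + 1)) x →L[ℝ] TangentSpace (𝓡 (2 * n + 1)) x)
      x (φ x))
  smooth_ξ : IsSmoothField (𝓡 (2 * n + 1)) ξ
  smooth_η : ContMDiff (𝓡 (2 * n + 1)) ((𝓡 (2 * n + 1)).prod
      𝓘(ℝ, EuclideanSpace ℝ (Fin (2 * n + 1)) →L[ℝ] ℝ)) ∞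
    (fun x : M ↦ TotalSpace.mk' (EuclideanSpace ℝ (Fin (2 * n + 1)) →L[ℝ] ℝ)
      (E := fun x : M ↦ TangentSpace (𝓡 (2 * n + 1)) x →L[ℝ] ℝ) x (η x))
  φ_φ : ∀ (x : M) (v : TangentSpace (𝓡 (2 * n + 1)) x), φ x (φ x v) = -v + η x v • ξ x
  φ_ξ : ∀ x : M, φ x (ξ x) = 0
  η_φ : ∀ (x : M) (v : TangentSpace (𝓡 (2 * n + 1)) x), η x (φ x v) = 0
  η_ξ : ∀ x : M, η x (ξ x) = 1
  g_φ_φ : ∀ (x : M) (v w : TangentSpace (𝓡 (2 * n + 1)) x),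
    g.inner x (φ x v) (φ x w) = g.inner x v w - η x v * η x w
  η_eq : ∀ (x : M) (v : TangentSpace (𝓡 (2 * n + 1)) x), η x v = g.inner x (ξ x) v

section Contact

variable {n : ℕ} {M : Type*} [TopologicalSpace M]
  [ChartedSpace (EuclideanSpace ℝ (Fin (2 * n + 1))) M] [IsManifold (𝓡 (2 * n + 1)) ∞ M]

/-- Up to a nonzero constant factor, the value of the `(2n+1)`-form `η ∧ (dη)ⁿ` on the vector
fields `V 0, …, V (2n)`. -/
def wedgePower (η : ∀ x : M, TangentSpace (𝓡 (2 * n + 1)) x →L[ℝ] ℝ)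
    (V : Fin (2 * n + 1) → ∀ x : M, TangentSpace (𝓡 (2 * n + 1)) x) (x : M) : ℝ :=
  ∑ σ : Equiv.Perm (Fin (2 * n + 1)), ((Equiv.Perm.sign σ : ℤ) : ℝ) *
    (η x (V (σ 0) x) * ∏ i : Fin n,
      dForm (𝓡 (2 * n + 1)) η (V (σ ⟨2 * i + 1, by omega⟩)) (V (σ ⟨2 * i + 2, by omega⟩)) x)

/-- `η` is a contact form: `η ∧ (dη)ⁿ ≠ 0` everywhere. -/
def IsContactForm (η : ∀ x : M, TangentSpace (𝓡 (2 * n + 1)) x →L[ℝ] ℝ) : Prop :=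
  ∀ x : M, ∃ V : Fin (2 * n + 1) → ∀ x : M, TangentSpace (𝓡 (2 * n + 1)) x,
    (∀ i, IsSmoothField (𝓡 (2 * n + 1)) (V i)) ∧ wedgePower η V x ≠ 0

namespace AlmostContactMetric

variable (S : AlmostContactMetric n M)

/-- The vector field `φX`. -/
def φField (X : ∀ x : M, TangentSpace (𝓡 (2 * n + 1)) x) (x : M) :
    TangentSpace (𝓡 (2 * n + 1)) x :=
  S.φ x (X x)

/-- The structure is a contact metric structure: `η` is a contact form, and
`dη(X, Y) = g(X, φY)`. -/
def IsContactMetric : Prop :=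
  IsContactForm S.η ∧
    ∀ X Y : ∀ x : M, TangentSpace (𝓡 (2 * n + 1)) x,
      IsSmoothField (𝓡 (2 * n + 1)) X → IsSmoothField (𝓡 (2 * n + 1)) Y →
        ∀ x, dForm (𝓡 (2 * n + 1)) S.η X Y x = S.g.inner x (X x) (S.φField Y x)

/-- The almost complex structure `J` on `M × ℝ` given by `JX = φX - η(X) ∂/∂t` and `J ∂/∂t = ξ`,
that is, `J(X + a ∂/∂t) = (φX + a ξ) - η(X) ∂/∂t`. -/
def coneJ (p : M × ℝ) : TangentSpace ((𝓡 (2 * n + 1)).prod 𝓘(ℝ, ℝ)) p →L[ℝ]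
    TangentSpace ((𝓡 (2 * n + 1)).prod 𝓘(ℝ, ℝ)) p :=
  let pr₁ : TangentSpace ((𝓡 (2 * n + 1)).prod 𝓘(ℝ, ℝ)) p →L[ℝ]
      TangentSpace (𝓡 (2 * n + 1)) p.1 :=
    ContinuousLinearMap.fst ℝ (TangentSpace (𝓡 (2 * n + 1)) p.1) ℝ
  let pr₂ : TangentSpace ((𝓡 (2 * n + 1)).prod 𝓘(ℝ, ℝ)) p →L[ℝ] ℝ :=
    ContinuousLinearMap.snd ℝ (TangentSpace (𝓡 (2 * n + 1)) p.1) ℝ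
  ((S.φ p.1).comp pr₁ + pr₂.smulRight (S.ξ p.1)).prod (-(S.η p.1).comp pr₁)

/-- The structure is normal: the almost complex structure `J` on `M × ℝ` is integrable. -/
def IsNormal : Prop :=
  IsIntegrable ((𝓡 (2 * n + 1)).prod 𝓘(ℝ, ℝ)) S.coneJ

/-- A Sasakian structure is a normal contact metric structure. -/
def IsSasakian : Prop :=
  S.IsContactMetric ∧ S.IsNormal

/-- The function `g(X, Y)`. -/
def gFun (X Y : ∀ x : M, TangentSpace (𝓡 (2 * n + 1)) x) (x : M) : ℝ :=
  S.g.inner x (X x) (Y x)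

/-- The function `η(X)`. -/
def ηFun (X : ∀ x : M, TangentSpace (𝓡 (2 * n + 1)) x) (x : M) : ℝ :=
  S.η x (X x)

/-- The function `Φ(X, Y) = g(φX, Y)`; in components, `φ_{ij} = g(φ ∂_i, ∂_j)`. -/
def ΦFun (X Y : ∀ x : M, TangentSpace (𝓡 (2 * n + 1)) x) (x : M) : ℝ :=
  S.g.inner x (S.φField X x) (Y x)

/-- The identity `(G₁)`:
`R_{ijkl} - φ_k^c φ_l^d R_{ijcd} = g_{il} g_{jk} - g_{jl} g_{ik} - φ_{il} φ_{jk} + φ_{jl} φ_{ik}`. -/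
def SatisfiesG₁ : Prop :=
  ∀ X Y Z W : ∀ x : M, TangentSpace (𝓡 (2 * n + 1)) x,
    IsSmoothField (𝓡 (2 * n + 1)) X → IsSmoothField (𝓡 (2 * n + 1)) Y →
    IsSmoothField (𝓡 (2 * n + 1)) Z → IsSmoothField (𝓡 (2 * n + 1)) W → ∀ x,
      curvature₄ S.g X Y Z W x - curvature₄ S.g X Y (S.φField Z) (S.φField W) x
        = S.gFun X W x * S.gFun Y Z x - S.gFun Y W x * S.gFun X Z x
          - S.ΦFun X W x * S.ΦFun Y Z x + S.ΦFun Y W x * S.ΦFun X Z x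

/-- The identity `(G₂)`:
`R_{ijkl} - φ_i^a φ_j^b R_{abkl} - φ_i^a φ_k^c R_{ajcl} - φ_i^a φ_l^d R_{ajkd}
  = g_{jk} η_i η_l - g_{jl} η_i η_k`. -/
def SatisfiesG₂ : Prop :=
  ∀ X Y Z W : ∀ x : M, TangentSpace (𝓡 (2 * n + 1)) x,
    IsSmoothField (𝓡 (2 * n + 1)) X → IsSmoothField (𝓡 (2 * n + 1)) Y →
    IsSmoothField (𝓡 (2 * n + 1)) Z → IsSmoothField (𝓡 (2 * n + 1)) W → ∀ x,
      curvature₄ S.g X Y Z W x - curvature₄ S.g (S.φField X) (S.φField Y) Z W x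
          - curvature₄ S.g (S.φField X) Y (S.φField Z) W x
          - curvature₄ S.g (S.φField X) Y Z (S.φField W) x
        = S.gFun Y Z x * S.ηFun X x * S.ηFun W x - S.gFun Y W x * S.ηFun X x * S.ηFun Z x

/-- The identity `(G₃)`:
`R_{ijkl} - φ_i^a φ_j^b φ_k^c φ_l^d R_{abcd}
  = g_{il} η_j η_k + g_{jk} η_i η_l - g_{ik} η_j η_l - g_{jl} η_i η_k`. -/
def SatisfiesG₃ : Prop :=
  ∀ X Y Z W : ∀ x : M, TangentSpace (𝓡 (2 * n + 1)) x,
    IsSmoothField (𝓡 (2 * n + 1)) X → IsSmoothField (𝓡 (2 * n + 1)) Y →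
    IsSmoothField (𝓡 (2 * n + 1)) Z → IsSmoothField (𝓡 (2 * n + 1)) W → ∀ x,
      curvature₄ S.g X Y Z W x
          - curvature₄ S.g (S.φField X) (S.φField Y) (S.φField Z) (S.φField W) x
        = S.gFun X W x * S.ηFun Y x * S.ηFun Z x + S.gFun Y Z x * S.ηFun X x * S.ηFun W x
          - S.gFun X Z x * S.ηFun Y x * S.ηFun W x - S.gFun Y W x * S.ηFun X x * S.ηFun Z x

end AlmostContactMetric

end Contact

end ContactGeometry

end

/-!
Only the case `Z = ξ` of the curvature identities matters. For `X = ξ` it says that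
`R(ξ, Y)ξ = η(Y)ξ - Y`, which on a contact metric manifold forces `(∇ξ + φ)² = 0`; as `∇ξ + φ` is
symmetric, `∇ξ = -φ`. It follows that `R(X, Y, ξ, W) = g((∇_W φ)X, Y)`, so that the case `Z = ξ`
becomes an equation for `∇φ`: with `D(w, v) = (∇_v φ)w - (g(w, v)ξ - η(w)v)`, it reads
`D(φw, φv) = 2D(w, v)`. Since also `D(φ²w, φ²v) = D(w, v)`, we get `D = 4D`, hence `D = 0`.

The torsion of `J` on `M × ℝ` is a tensor, and `∂/∂t = -Jξ`, so it vanishes as soon as it vanishes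
on pairs of vector fields lifted from `M`. There its components are combinations of `∇φ` and `∇ξ`
which are zero because `D = 0`.
-/

noncomputable section

namespace ContactGeometry

/-! ### Calculus of smooth vector fields -/

section Fields

variable {E : Type*} [NormedAddCommGroup E] [NormedSpace ℝ E]
  {H : Type*} [TopologicalSpace H] {I : ModelWithCorners ℝ E H}
  {M : Type*} [TopologicalSpace M] [ChartedSpace H M] [IsManifold I ∞ M]
  {X Y Z : ∀ x : M, TangentSpace I x} {f : M → ℝ}

namespace IsSmoothField

theorem mdiffAt (hX : IsSmoothField I X) (x : M) : MDiffAt (T% X) x :=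
  ContMDiff.mdifferentiableAt hX (by simp)

theorem add (hX : IsSmoothField I X) (hY : IsSmoothField I Y) : IsSmoothField I (X + Y) :=
  ContMDiff.add_section hX hY

theorem sub (hX : IsSmoothField I X) (hY : IsSmoothField I Y) : IsSmoothField I (X - Y) :=
  ContMDiff.sub_section hX hY

theorem neg (hX : IsSmoothField I X) : IsSmoothField I (-X) :=
  ContMDiff.neg_section hX

theorem smul (hf : CMDiff ∞ f) (hX : IsSmoothField I X) : IsSmoothField I (f • X) :=
  ContMDiff.smul_section hf hX

theorem const_smul (c : ℝ) (hX : IsSmoothField I X) : IsSmoothField I (c • X) :=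
  ContMDiff.const_smul_section hX

theorem mlieBracket [CompleteSpace E] (hX : IsSmoothField I X) (hY : IsSmoothField I Y) :
    IsSmoothField I (mlieBracket I X Y) := by
  have : IsManifold I (((⊤ : ℕ∞) : WithTop ℕ∞) + 1) M := by simpa using ‹IsManifold I ∞ M›
  have : IsManifold I (minSmoothness ℝ 2) M := by simpa using (inferInstance : IsManifold I 2 M)
  intro x
  exact ContMDiffAt.mlieBracket_vectorField (m := (⊤ : ℕ∞)) (n := (⊤ : ℕ∞)) (hX x) (hY x) (by simp)

theorem mvfderiv (hX : IsSmoothField I X) (hf : CMDiff ∞ f) :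
    CMDiff ∞ (fun x ↦ mvfderiv I f x (X x)) :=
  (contMDiff_snd_tangentBundle_modelSpace ℝ 𝓘(ℝ, ℝ)).comp
    ((hf.contMDiff_tangentMap (m := ∞) (by simp)).comp hX)

end IsSmoothField

theorem isSmoothField_zero : IsSmoothField I (0 : ∀ x : M, TangentSpace I x) :=
  Bundle.contMDiff_zeroSection ℝ (TangentSpace I : M → Type _)

theorem exists_isSmoothField_apply_eq [FiniteDimensional ℝ E] [T2Space M] (x : M)
    (v : TangentSpace I x) : ∃ X : ∀ x : M, TangentSpace I x, IsSmoothField I X ∧ X x = v := by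
  obtain ⟨s, hs, h⟩ := FiberBundle.exists_contMDiffOn_extend (k := ∞) I E
    (V := fun x : M ↦ TangentSpace I x) v
  obtain ⟨f, -, hf⟩ := (SmoothBumpFunction.nhds_basis_tsupport (I := I) x).mem_iff.1
    (interior_mem_nhds.2 hs)
  refine ⟨(f : M → ℝ) • FiberBundle.extend E v, ?_, by simp⟩
  exact ContMDiffOn.smul_section_of_tsupport f.contMDiff.contMDiffOn isOpen_interior hf
    (h.mono interior_subset)

theorem mlieBracket_jacobi [CompleteSpace E] (hX : IsSmoothField I X) (hY : IsSmoothField I Y)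
    (hZ : IsSmoothField I Z) (x : M) :
    mlieBracket I X (mlieBracket I Y Z) x =
      mlieBracket I (mlieBracket I X Y) Z x + mlieBracket I Y (mlieBracket I X Z) x := by
  have : IsManifold I (minSmoothness ℝ 3) M := by simpa using (inferInstance : IsManifold I 3 M)
  have two_le : minSmoothness ℝ 2 ≤ ∞ := by simpa using (ENat.LEInfty.out : (2 : WithTop ℕ∞) ≤ ∞)
  exact leibniz_identity_mlieBracket_apply ((hX x).of_le two_le) ((hY x).of_le two_le)
    ((hZ x).of_le two_le)

theorem mlieBracket_mlieBracket_smul [CompleteSpace E] (hY : IsSmoothField I Y)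
    (hZ : IsSmoothField I Z) (hf : CMDiff ∞ f) (x : M) :
    mlieBracket I X (mlieBracket I Y (f • Z)) x =
      mvfderiv I (fun y ↦ mvfderiv I f y (Y y)) x (X x) • Z x
        + mvfderiv I f x (Y x) • mlieBracket I X Z x
        + (mvfderiv I f x (X x) • mlieBracket I Y Z x
          + f x • mlieBracket I X (mlieBracket I Y Z) x) := by
  have : IsManifold I 2 M := inferInstance
  have hf' (y : M) : MDiffAt f y := hf.mdifferentiableAt (by simp)
  have hYf := hY.mvfderiv hf
  have bracket_smul : mlieBracket I Y (f • Z)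
      = (fun y ↦ mvfderiv I f y (Y y)) • Z + f • mlieBracket I Y Z :=
    funext fun y ↦ mlieBracket_smul_right (hf' y) (hZ.mdiffAt y)
  rw [bracket_smul,
    mlieBracket_add_right ((hZ.smul hYf).mdiffAt x) (((hY.mlieBracket hZ).smul hf).mdiffAt x),
    mlieBracket_smul_right (hYf.mdifferentiableAt (by simp)) (hZ.mdiffAt x),
    mlieBracket_smul_right (hf' x) ((hY.mlieBracket hZ).mdiffAt x)]

/- Compare the coefficients of `Z` in the Jacobi identity for `X`, `Y` and `f • Z`. -/
theorem mvfderiv_mlieBracket_of_ne_zero [CompleteSpace E] (hX : IsSmoothField I X)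
    (hY : IsSmoothField I Y) (hf : CMDiff ∞ f) (hZ : IsSmoothField I Z) {x : M} (hx : Z x ≠ 0) :
    mvfderiv I f x (mlieBracket I X Y x) =
      mvfderiv I (fun y ↦ mvfderiv I f y (Y y)) x (X x)
        - mvfderiv I (fun y ↦ mvfderiv I f y (X y)) x (Y x) := by
  have : IsManifold I 2 M := inferInstance
  have jacobi := mlieBracket_jacobi hX hY (hZ.smul hf) x
  rw [mlieBracket_mlieBracket_smul hY hZ hf, mlieBracket_mlieBracket_smul hX hZ hf,
    mlieBracket_smul_right (hf.mdifferentiableAt (by simp)) (hZ.mdiffAt x),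
    mlieBracket_jacobi hX hY hZ, ← sub_eq_zero] at jacobi
  have coeff_smul : (mvfderiv I (fun y ↦ mvfderiv I f y (Y y)) x (X x)
      - mvfderiv I (fun y ↦ mvfderiv I f y (X y)) x (Y x)
      - mvfderiv I f x (mlieBracket I X Y x)) • Z x = 0 := by
    rw [← jacobi]
    module
  exact (sub_eq_zero.1 ((smul_eq_zero.1 coeff_smul).resolve_right hx)).symm

theorem mvfderiv_mlieBracket [CompleteSpace E] (hX : IsSmoothField I X) (hY : IsSmoothField I Y)
    (hf : CMDiff ∞ f) (x : M) :
    mvfderiv I f x (mlieBracket I X Y x) =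
      mvfderiv I (fun y ↦ mvfderiv I f y (Y y)) x (X x)
        - mvfderiv I (fun y ↦ mvfderiv I f y (X y)) x (Y x) := by
  rcases ne_or_eq (X x) 0 with hXx | hXx
  · exact mvfderiv_mlieBracket_of_ne_zero hX hY hf hX hXx
  rcases ne_or_eq (Y x) 0 with hYx | hYx
  · exact mvfderiv_mlieBracket_of_ne_zero hX hY hf hY hYx
  rcases ne_or_eq (mlieBracket I X Y x) 0 with hXY | hXY
  · exact mvfderiv_mlieBracket_of_ne_zero hX hY hf (hX.mlieBracket hY) hXY
  · simp [hXx, hYx, hXY]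

theorem eq_zero_of_forall_mvfderiv_eq_zero [FiniteDimensional ℝ E] [T2Space M] {x : M}
    {v : TangentSpace I x} (h : ∀ f : M → ℝ, CMDiff ∞ f → mvfderiv I f x v = 0) : v = 0 := by
  have : IsManifold I 1 M := inferInstance
  obtain ⟨ρ⟩ : Nonempty (SmoothBumpFunction I x) := inferInstance
  have chart_eq_zero : mvfderiv I (extChartAt I x) x v = 0 := by
    by_contra hne
    obtain ⟨ℓ, hℓ⟩ := SeparatingDual.exists_ne_zero (R := ℝ) hne
    have smooth : CMDiff ∞ (fun y ↦ ρ y • ℓ (extChartAt I x y)) :=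
      ρ.contMDiff_smul (ℓ.contMDiff.comp_contMDiffOn contMDiffOn_extChartAt)
    have near : (fun y ↦ ρ y • ℓ (extChartAt I x y)) =ᶠ[nhds x] ℓ ∘ extChartAt I x := by
      filter_upwards [ρ.eventuallyEq_one] with y hy
      simp [hy]
    have deriv_eq_zero := h _ smooth
    rw [mvfderiv, ContinuousLinearMap.comp_apply, near.mfderiv_eq,
      mfderiv_comp x ℓ.mdifferentiableAt (mdifferentiableAt_extChartAt (mem_chart_source H x)),
      ContinuousLinearMap.mfderiv_eq] at deriv_eq_zero
    exact hℓ deriv_eq_zero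
  refine (isInvertible_mfderiv_extChartAt (I := I) (mem_extChartAt_source x)).injective ?_
  rw [map_zero]
  exact chart_eq_zero

end Fields

/-! ### The exterior derivative is closed -/

section ExteriorDerivative

variable {E : Type*} [NormedAddCommGroup E] [NormedSpace ℝ E] [CompleteSpace E]
  {H : Type*} [TopologicalSpace H] {I : ModelWithCorners ℝ E H}
  {M : Type*} [TopologicalSpace M] [ChartedSpace H M] [IsManifold I ∞ M]
  {X Y Z : ∀ x : M, TangentSpace I x}

theorem mlieBracket_cyclic_sum (hX : IsSmoothField I X) (hY : IsSmoothField I Y)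
    (hZ : IsSmoothField I Z) (x : M) :
    mlieBracket I (mlieBracket I X Y) Z x + mlieBracket I (mlieBracket I Y Z) X x
      + mlieBracket I (mlieBracket I Z X) Y x = 0 := by
  have : IsManifold I 2 M := inferInstance
  have swap : mlieBracket I (mlieBracket I Z X) Y x = mlieBracket I Y (mlieBracket I X Z) x := by
    rw [mlieBracket_swap (V := Z), mlieBracket_swap_apply, ← neg_one_smul ℝ (mlieBracket I X Z),
      mlieBracket_const_smul_right ((hX.mlieBracket hZ).mdiffAt x), neg_one_smul, neg_neg]
  rw [swap, mlieBracket_swap_apply (V := mlieBracket I Y Z), mlieBracket_jacobi hX hY hZ]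
  abel

variable {η : ∀ x : M, TangentSpace I x →L[ℝ] ℝ}

theorem mvfderiv_dForm (hη : ∀ X, IsSmoothField I X → CMDiff ∞ (fun y ↦ η y (X y)))
    (hX : IsSmoothField I X) (hY : IsSmoothField I Y) (x : M) (v : TangentSpace I x) :
    mvfderiv I (dForm I η X Y) x v =
      (1 / 2 : ℝ) * (mvfderiv I (fun y ↦ mvfderiv I (fun z ↦ η z (Y z)) y (X y)) x v
        - mvfderiv I (fun y ↦ mvfderiv I (fun z ↦ η z (X z)) y (Y y)) x v
        - mvfderiv I (fun y ↦ η y (mlieBracket I X Y y)) x v) := by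
  have hXη := (hX.mvfderiv (hη Y hY)).mdifferentiableAt (x := x) (by simp)
  have hYη := (hY.mvfderiv (hη X hX)).mdifferentiableAt (x := x) (by simp)
  have hη' := (hη _ (hX.mlieBracket hY)).mdifferentiableAt (x := x) (by simp)
  have dForm_eq : dForm I η X Y = (fun _ ↦ (1 / 2 : ℝ)) *
      ((fun y ↦ mvfderiv I (fun z ↦ η z (Y z)) y (X y))
        - (fun y ↦ mvfderiv I (fun z ↦ η z (X z)) y (Y y))
        - fun y ↦ η y (mlieBracket I X Y y)) := rfl
  rw [dForm_eq, mvfderiv_mul mdifferentiableAt_const ((hXη.sub hYη).sub hη'),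
    mvfderiv_sub (hXη.sub hYη) hη', mvfderiv_sub hXη hYη, mvfderiv_const]
  simp

theorem cyclic_sum_mvfderiv_dForm (hη : ∀ X, IsSmoothField I X → CMDiff ∞ (fun y ↦ η y (X y)))
    (hX : IsSmoothField I X) (hY : IsSmoothField I Y) (hZ : IsSmoothField I Z) (x : M) :
    mvfderiv I (dForm I η Y Z) x (X x) + mvfderiv I (dForm I η Z X) x (Y x)
        + mvfderiv I (dForm I η X Y) x (Z x) =
      dForm I η (mlieBracket I X Y) Z x + dForm I η (mlieBracket I Y Z) X x
        + dForm I η (mlieBracket I Z X) Y x := by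
  have jacobi := congrArg (η x) (mlieBracket_cyclic_sum hX hY hZ x)
  rw [map_add, map_add, map_zero] at jacobi
  rw [mvfderiv_dForm hη hY hZ, mvfderiv_dForm hη hZ hX, mvfderiv_dForm hη hX hY, dForm, dForm,
    dForm, mvfderiv_mlieBracket hX hY (hη Z hZ), mvfderiv_mlieBracket hY hZ (hη X hX),
    mvfderiv_mlieBracket hZ hX (hη Y hY)]
  linear_combination (1 / 2 : ℝ) * jacobi

end ExteriorDerivative

/-! ### The Levi-Civita connection as a covariant derivative -/

section Connection

variable {E : Type*} [NormedAddCommGroup E] [NormedSpace ℝ E]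
  {H : Type*} [TopologicalSpace H] {I : ModelWithCorners ℝ E H}
  {M : Type*} [TopologicalSpace M] [ChartedSpace H M] [IsManifold I ∞ M]
  (g : ContMDiffRiemannianMetric I ∞ E (fun x : M ↦ TangentSpace I x))
  {X Y Z : ∀ x : M, TangentSpace I x} {x : M}

theorem IsSmoothField.inner (hX : IsSmoothField I X) (hY : IsSmoothField I Y) :
    CMDiff ∞ (fun y ↦ g.inner y (X y) (Y y)) := by
  let : RiemannianBundle (fun x : M ↦ TangentSpace I x) := ⟨g.toRiemannianMetric⟩
  exact ContMDiff.inner_bundle (IB := I) (F := E) (E := fun x : M ↦ TangentSpace I x) hX hY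

theorem eq_zero_of_inner_self_eq_zero {v : TangentSpace I x} (h : g.inner x v v = 0) : v = 0 := by
  by_contra hne
  exact (g.pos x v hne).ne' h

theorem eq_of_forall_inner_eq {u v : TangentSpace I x}
    (h : ∀ w, g.inner x u w = g.inner x v w) : u = v := by
  refine sub_eq_zero.1 (eq_zero_of_inner_self_eq_zero g ?_)
  simp only [map_sub, sub_apply, h, sub_self]

theorem exists_mdiffAt_apply_eq (v : TangentSpace I x) :
    ∃ X : ∀ x : M, TangentSpace I x, MDiffAt (T% X) x ∧ X x = v :=
  have : IsManifold I 1 M := inferInstance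
  ⟨FiberBundle.extend E v, FiberBundle.mdifferentiableAt_extend I E v, by simp⟩

variable [FiniteDimensional ℝ E]

theorem leviCivita_add_right (hX : MDiffAt (T% X) x) (hY : MDiffAt (T% Y) x)
    (hZ : MDiffAt (T% Z) x) :
    leviCivita g X (Y + Z) x = leviCivita g X Y x + leviCivita g X Z x := by
  refine eq_of_forall_inner_eq g fun w ↦ ?_
  obtain ⟨W, hW, rfl⟩ := exists_mdiffAt_apply_eq w
  have metric_add := leviCivita_metric g hX (mdifferentiableAt_add_section hY hZ) hW
  have inner_add : (fun y ↦ g.inner y ((Y + Z) y) (W y))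
      = (fun y ↦ g.inner y (Y y) (W y)) + fun y ↦ g.inner y (Z y) (W y) := by
    ext y; simp
  rw [inner_add, mvfderiv_add (mdiff_inner g hY hW) (mdiff_inner g hZ hW), add_apply,
    leviCivita_metric g hX hY hW, leviCivita_metric g hX hZ hW] at metric_add
  simp only [Pi.add_apply, map_add, add_apply] at metric_add ⊢
  linarith

theorem leviCivita_smul_right {f : M → ℝ} (hf : MDiffAt f x) (hX : MDiffAt (T% X) x)
    (hY : MDiffAt (T% Y) x) :
    leviCivita g X (f • Y) x = mvfderiv I f x (X x) • Y x + f x • leviCivita g X Y x := by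
  refine eq_of_forall_inner_eq g fun w ↦ ?_
  obtain ⟨W, hW, rfl⟩ := exists_mdiffAt_apply_eq w
  have metric_smul := leviCivita_metric g hX (hf.smul_section hY) hW
  have inner_smul : (fun y ↦ g.inner y ((f • Y) y) (W y))
      = f * fun y ↦ g.inner y (Y y) (W y) := by
    ext y; simp
  rw [inner_smul, mvfderiv_mul hf (mdiff_inner g hY hW), add_apply, smul_apply, smul_apply,
    leviCivita_metric g hX hY hW] at metric_smul
  simp only [Pi.smul_apply', map_add, map_smul, add_apply, smul_apply, smul_eq_mul]
    at metric_smul ⊢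
  linarith

theorem leviCivita_tensorialAt (hY : MDiffAt (T% Y) x) :
    TensorialAt I E (fun X ↦ leviCivita g X Y x) x where
  smul := by
    intro f X hf hX
    have : IsManifold I 2 M := inferInstance
    rw [sub_eq_iff_eq_add.1 (leviCivita_torsion_free g (hf.smul_section hX) hY),
      leviCivita_smul_right g hf hY hX, mlieBracket_smul_left hf hX,
      ← leviCivita_torsion_free g hX hY]
    module
  add := by
    intro X X' hX hX'
    have : IsManifold I 2 M := inferInstance
    rw [sub_eq_iff_eq_add.1 (leviCivita_torsion_free g (mdifferentiableAt_add_section hX hX') hY),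
      leviCivita_add_right g hY hX hX', mlieBracket_add_left hX hX',
      ← leviCivita_torsion_free g hX hY, ← leviCivita_torsion_free g hX' hY]
    module

open Classical in
/-- The covariant derivative `v ↦ ∇_v Y` at `x` of the Levi-Civita connection, as a linear map;
junk value `0` when `Y` is not differentiable at `x`. -/
def leviCivitaHom (Y : ∀ x : M, TangentSpace I x) (x : M) :
    TangentSpace I x →L[ℝ] TangentSpace I x :=
  have : IsManifold I 1 M := inferInstance
  if h : MDiffAt (T% Y) x then
    TensorialAt.mkHom (fun X ↦ leviCivita g X Y x) x (leviCivita_tensorialAt g h)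
  else 0

theorem leviCivitaHom_apply (hX : MDiffAt (T% X) x) (hY : MDiffAt (T% Y) x) :
    leviCivitaHom g Y x (X x) = leviCivita g X Y x := by
  rw [leviCivitaHom, dif_pos hY]
  exact TensorialAt.mkHom_apply (leviCivita_tensorialAt g hY) hX

/-- The Levi-Civita connection of `g` as a covariant derivative on the tangent bundle. -/
def nabla : CovariantDerivative I E (TangentSpace I : M → Type _) where
  toFun := leviCivitaHom g
  isCovariantDerivativeOnUniv :=
    { add := by
        intro Y Z x hY hZ _
        ext v
        obtain ⟨X, hX, rfl⟩ := exists_mdiffAt_apply_eq v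
        rw [leviCivitaHom_apply g hX (mdifferentiableAt_add_section hY hZ),
          leviCivita_add_right g hX hY hZ, add_apply, leviCivitaHom_apply g hX hY,
          leviCivitaHom_apply g hX hZ]
      leibniz := by
        intro Y f x hY hf _
        ext v
        obtain ⟨X, hX, rfl⟩ := exists_mdiffAt_apply_eq v
        rw [leviCivitaHom_apply g hX (hf.smul_section hY), leviCivita_smul_right g hf hX hY,
          add_comm]
        simp [leviCivitaHom_apply g hX hY] }

theorem leviCivita_eq_nabla (hX : MDiffAt (T% X) x) (hY : MDiffAt (T% Y) x) :
    leviCivita g X Y x = nabla g Y x (X x) :=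
  (leviCivitaHom_apply g hX hY).symm

theorem nabla_add (hY : MDiffAt (T% Y) x) (hZ : MDiffAt (T% Z) x) (v : TangentSpace I x) :
    nabla g (Y + Z) x v = nabla g Y x v + nabla g Z x v := by
  rw [(nabla g).isCovariantDerivativeOn.add hY hZ, add_apply]

theorem nabla_smul {f : M → ℝ} (hf : MDiffAt f x) (hY : MDiffAt (T% Y) x) (v : TangentSpace I x) :
    nabla g (f • Y) x v = f x • nabla g Y x v + mvfderiv I f x v • Y x := by
  simp [(nabla g).isCovariantDerivativeOn.leibniz hY hf]

theorem nabla_neg (hY : MDiffAt (T% Y) x) (v : TangentSpace I x) :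
    nabla g (-Y) x v = -nabla g Y x v := by
  rw [← neg_one_smul ℝ Y, (nabla g).isCovariantDerivativeOn.smul_const _ hY]
  simp

theorem mvfderiv_inner (hY : MDiffAt (T% Y) x) (hZ : MDiffAt (T% Z) x) (v : TangentSpace I x) :
    mvfderiv I (fun y ↦ g.inner y (Y y) (Z y)) x v
      = g.inner x (nabla g Y x v) (Z x) + g.inner x (Y x) (nabla g Z x v) := by
  obtain ⟨X, hX, rfl⟩ := exists_mdiffAt_apply_eq v
  rw [leviCivita_metric g hX hY hZ, leviCivita_eq_nabla g hX hY, leviCivita_eq_nabla g hX hZ]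

theorem nabla_sub_nabla (hX : MDiffAt (T% X) x) (hY : MDiffAt (T% Y) x) :
    nabla g Y x (X x) - nabla g X x (Y x) = mlieBracket I X Y x := by
  rw [← leviCivita_torsion_free g hX hY, leviCivita_eq_nabla g hX hY, leviCivita_eq_nabla g hY hX]

theorem curvature_zero_right (hX : IsSmoothField I X) (hY : IsSmoothField I Y) :
    curvature g X Y 0 x = 0 := by
  have : CompleteSpace E := FiniteDimensional.complete ℝ E
  have leviCivita_zero_right {Z : ∀ x : M, TangentSpace I x} (hZ : IsSmoothField I Z) :
      leviCivita g Z 0 = 0 := by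
    ext1 y
    rw [leviCivita_eq_nabla g (hZ.mdiffAt y) (isSmoothField_zero.mdiffAt y), (nabla g).zero]
    simp
  rw [curvature, leviCivita_zero_right hX, leviCivita_zero_right hY, leviCivita_zero_right hX,
    leviCivita_zero_right (hX.mlieBracket hY)]
  simp

end Connection

/-! ### The Nijenhuis torsion as a tensor -/

section Nijenhuis

variable {E : Type*} [NormedAddCommGroup E] [NormedSpace ℝ E]
  {H : Type*} [TopologicalSpace H] {I : ModelWithCorners ℝ E H}
  {M : Type*} [TopologicalSpace M] [ChartedSpace H M]
  {J : ∀ x : M, TangentSpace I x →L[ℝ] TangentSpace I x} {X Y : ∀ x : M, TangentSpace I x} {x : M}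

theorem nijenhuis_swap : nijenhuis I J X Y x = -nijenhuis I J Y X x := by
  simp only [nijenhuis]
  rw [mlieBracket_swap_apply (V := X) (W := Y),
    mlieBracket_swap_apply (V := fun y ↦ J y (X y)) (W := fun y ↦ J y (Y y)),
    mlieBracket_swap_apply (V := fun y ↦ J y (X y)) (W := Y),
    mlieBracket_swap_apply (V := X) (W := fun y ↦ J y (Y y))]
  simp only [map_neg]
  abel

theorem nijenhuis_self : nijenhuis I J X X x = 0 := by
  have swap : nijenhuis I J X X x = -nijenhuis I J X X x := nijenhuis_swap
  linear_combination (norm := module) (1 / 2 : ℝ) • swap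

variable [CompleteSpace E] [IsManifold I ∞ M]

theorem nijenhuis_apply_right (hJ : ∀ y v, J y (J y v) = -v) (hY : MDiffAt (T% Y) x) :
    nijenhuis I J X (fun y ↦ J y (Y y)) x = -J x (nijenhuis I J X Y x) := by
  have : IsManifold I 2 M := inferInstance
  have J_J_field : (fun y ↦ J y (J y (Y y))) = (-1 : ℝ) • Y := by
    ext1 y
    simp [hJ]
  rw [nijenhuis, J_J_field, mlieBracket_const_smul_right hY, mlieBracket_const_smul_right hY,
    nijenhuis]
  simp only [map_add, map_sub, map_neg, map_smul, hJ]
  module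

theorem nijenhuis_tensorialAt_left
    (hJ : ∀ X : (∀ x : M, TangentSpace I x), MDiffAt (T% X) x →
      MDiffAt (T% fun y ↦ J y (X y)) x) :
    TensorialAt I E (fun X ↦ nijenhuis I J X Y x) x where
  smul {f X} hf hX := by
    have : IsManifold I 2 M := inferInstance
    have J_smul : (fun y ↦ J y ((f • X) y)) = f • fun y ↦ J y (X y) := by
      ext1 y
      simp
    simp only [nijenhuis, J_smul, mlieBracket_smul_left hf hX, mlieBracket_smul_left hf (hJ X hX),
      map_add, map_smul]
    module
  add {X X'} hX hX' := by
    have : IsManifold I 2 M := inferInstance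
    have J_add : (fun y ↦ J y ((X + X') y)) = (fun y ↦ J y (X y)) + fun y ↦ J y (X' y) := by
      ext1 y
      simp
    simp only [nijenhuis, J_add, mlieBracket_add_left hX hX',
      mlieBracket_add_left (hJ X hX) (hJ X' hX'), map_add]
    abel

theorem nijenhuis_tensorialAt_right
    (hJ : ∀ X : (∀ x : M, TangentSpace I x), MDiffAt (T% X) x →
      MDiffAt (T% fun y ↦ J y (X y)) x) :
    TensorialAt I E (fun Y ↦ nijenhuis I J X Y x) x where
  smul hf hY := by
    rw [nijenhuis_swap, (nijenhuis_tensorialAt_left hJ).smul hf hY, nijenhuis_swap (X := X),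
      smul_neg]
  add hY hY' := by
    rw [nijenhuis_swap, (nijenhuis_tensorialAt_left hJ).add hY hY', nijenhuis_swap (X := X),
      nijenhuis_swap (X := X), neg_add]

end Nijenhuis

/-! ### Vector fields on `M × ℝ` -/

section Product

variable {E : Type*} [NormedAddCommGroup E] [NormedSpace ℝ E]
  {H : Type*} [TopologicalSpace H] {I : ModelWithCorners ℝ E H}
  {M : Type*} [TopologicalSpace M] [ChartedSpace H M]
  {X Y : ∀ x : M, TangentSpace I x} {p : M × ℝ}

variable (I) in
/-- The component along `M` of a tangent vector of `M × ℝ`. -/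
def hor (p : M × ℝ) : TangentSpace (I.prod 𝓘(ℝ, ℝ)) p →L[ℝ] TangentSpace I p.1 :=
  ContinuousLinearMap.fst ℝ (TangentSpace I p.1) ℝ

variable (I) in
/-- The component along `ℝ` of a tangent vector of `M × ℝ`. -/
def ver (p : M × ℝ) : TangentSpace (I.prod 𝓘(ℝ, ℝ)) p →L[ℝ] ℝ :=
  ContinuousLinearMap.snd ℝ (TangentSpace I p.1) ℝ

theorem hor_ver_ext {u v : TangentSpace (I.prod 𝓘(ℝ, ℝ)) p} (h_hor : hor I p u = hor I p v)
    (h_ver : ver I p u = ver I p v) : u = v :=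
  Prod.ext h_hor h_ver

/-- The vector field `V + a ∂/∂t` on `M × ℝ`, where `V` and `a` may depend on `t`. -/
def prodField (V : ∀ p : M × ℝ, TangentSpace I p.1) (a : M × ℝ → ℝ) (p : M × ℝ) :
    TangentSpace (I.prod 𝓘(ℝ, ℝ)) p :=
  (V p, a p)

/-- The vector field on `M × ℝ` tangent to the slices and induced by a vector field on `M`. -/
def lift (X : ∀ x : M, TangentSpace I x) : ∀ p : M × ℝ, TangentSpace (I.prod 𝓘(ℝ, ℝ)) p :=
  prodField (fun p ↦ X p.1) (fun _ ↦ 0)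

variable (I) in
/-- The vector field `∂/∂t` on `M × ℝ`. -/
def dt : ∀ p : M × ℝ, TangentSpace (I.prod 𝓘(ℝ, ℝ)) p :=
  prodField (fun _ ↦ 0) (fun _ ↦ 1)

@[simp]
theorem hor_prodField (V : ∀ p : M × ℝ, TangentSpace I p.1) (a : M × ℝ → ℝ) :
    hor I p (prodField V a p) = V p :=
  rfl

@[simp]
theorem ver_prodField (V : ∀ p : M × ℝ, TangentSpace I p.1) (a : M × ℝ → ℝ) :
    ver I p (prodField V a p) = a p :=
  rfl

@[simp]
theorem hor_lift (p : M × ℝ) : hor I p (lift X p) = X p.1 :=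
  rfl

@[simp]
theorem ver_lift (p : M × ℝ) : ver I p (lift X p) = 0 :=
  rfl

@[simp]
theorem hor_dt (p : M × ℝ) : hor I p (dt I p) = 0 :=
  rfl

@[simp]
theorem ver_dt (p : M × ℝ) : ver I p (dt I p) = 1 :=
  rfl

theorem contMDiff_real_tangent {a : M × ℝ → ℝ} (ha : ContMDiff (I.prod 𝓘(ℝ, ℝ)) 𝓘(ℝ, ℝ) ∞ a) :
    ContMDiff (I.prod 𝓘(ℝ, ℝ)) 𝓘(ℝ, ℝ).tangent ∞
      (fun p : M × ℝ ↦ (⟨p.2, a p⟩ : TangentBundle 𝓘(ℝ, ℝ) ℝ)) := by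
  intro p
  rw [contMDiffAt_totalSpace]
  exact ⟨contMDiff_snd.contMDiffAt, by simpa using ha p⟩

theorem mdifferentiableAt_real_tangent {a : M × ℝ → ℝ}
    (ha : MDifferentiableAt (I.prod 𝓘(ℝ, ℝ)) 𝓘(ℝ, ℝ) a p) :
    MDifferentiableAt (I.prod 𝓘(ℝ, ℝ)) 𝓘(ℝ, ℝ).tangent
      (fun p : M × ℝ ↦ (⟨p.2, a p⟩ : TangentBundle 𝓘(ℝ, ℝ) ℝ)) p := by
  rw [mdifferentiableAt_totalSpace]
  exact ⟨mdifferentiableAt_snd, by simpa using ha⟩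

theorem mvfderiv_comp_fst {f : M → ℝ} (hf : MDifferentiableAt I 𝓘(ℝ, ℝ) f p.1)
    (v : TangentSpace (I.prod 𝓘(ℝ, ℝ)) p) :
    mvfderiv (I.prod 𝓘(ℝ, ℝ)) (fun q : M × ℝ ↦ f q.1) p v = mvfderiv I f p.1 (hor I p v) := by
  have chain_rule := mvfderiv_comp_apply (f := (Prod.fst : M × ℝ → M)) (g := f) p hf
    (mdifferentiableAt_fst (I := I) (I' := 𝓘(ℝ, ℝ))) v
  rwa [mfderiv_fst] at chain_rule

theorem mvfderiv_snd (v : TangentSpace (I.prod 𝓘(ℝ, ℝ)) p) :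
    mvfderiv (I.prod 𝓘(ℝ, ℝ)) (fun q : M × ℝ ↦ q.2) p v = ver I p v := by
  rw [mvfderiv, show mfderiv (I.prod 𝓘(ℝ, ℝ)) 𝓘(ℝ, ℝ) (fun q : M × ℝ ↦ q.2) p = _ from mfderiv_snd]
  rfl

variable [IsManifold I ∞ M]

theorem isSmoothField_prodField {V : ∀ p : M × ℝ, TangentSpace I p.1} {a : M × ℝ → ℝ}
    (hV : ContMDiff (I.prod 𝓘(ℝ, ℝ)) I.tangent ∞
      (fun p : M × ℝ ↦ (⟨p.1, V p⟩ : TangentBundle I M)))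
    (ha : ContMDiff (I.prod 𝓘(ℝ, ℝ)) 𝓘(ℝ, ℝ) ∞ a) :
    IsSmoothField (I.prod 𝓘(ℝ, ℝ)) (prodField V a) :=
  have : IsManifold I 1 M := inferInstance
  contMDiff_equivTangentBundleProd_symm.comp (hV.prodMk (contMDiff_real_tangent ha))

theorem mdiffAt_prodField {V : ∀ p : M × ℝ, TangentSpace I p.1} {a : M × ℝ → ℝ}
    (hV : MDifferentiableAt (I.prod 𝓘(ℝ, ℝ)) I.tangent
      (fun p : M × ℝ ↦ (⟨p.1, V p⟩ : TangentBundle I M)) p)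
    (ha : MDifferentiableAt (I.prod 𝓘(ℝ, ℝ)) 𝓘(ℝ, ℝ) a p) :
    MDiffAt (T% (prodField V a)) p :=
  have : IsManifold I 1 M := inferInstance
  (contMDiff_equivTangentBundleProd_symm (n := 1).mdifferentiableAt one_ne_zero).comp p
    (hV.prodMk (mdifferentiableAt_real_tangent ha))

theorem mdifferentiableAt_hor {U : ∀ p : M × ℝ, TangentSpace (I.prod 𝓘(ℝ, ℝ)) p}
    (hU : MDiffAt (T% U) p) :
    MDifferentiableAt (I.prod 𝓘(ℝ, ℝ)) I.tangent
      (fun p : M × ℝ ↦ (⟨p.1, hor I p (U p)⟩ : TangentBundle I M)) p :=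
  have : IsManifold I 1 M := inferInstance
  mdifferentiableAt_fst.comp p
    (((contMDiff_equivTangentBundleProd (I := I) (I' := 𝓘(ℝ, ℝ)) (M := M) (M' := ℝ)
      (n := 1)).mdifferentiableAt one_ne_zero).comp p hU)

theorem mdifferentiableAt_ver {U : ∀ p : M × ℝ, TangentSpace (I.prod 𝓘(ℝ, ℝ)) p}
    (hU : MDiffAt (T% U) p) :
    MDifferentiableAt (I.prod 𝓘(ℝ, ℝ)) 𝓘(ℝ, ℝ) (fun p : M × ℝ ↦ ver I p (U p)) p :=
  have : IsManifold I 1 M := inferInstance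
  ((contMDiff_snd_tangentBundle_modelSpace ℝ 𝓘(ℝ, ℝ) (n := 1)).mdifferentiableAt
    one_ne_zero).comp p (mdifferentiableAt_snd.comp p
      (((contMDiff_equivTangentBundleProd (I := I) (I' := 𝓘(ℝ, ℝ)) (M := M) (M' := ℝ)
        (n := 1)).mdifferentiableAt one_ne_zero).comp p hU))

theorem isSmoothField_lift (hX : IsSmoothField I X) :
    IsSmoothField (I.prod 𝓘(ℝ, ℝ)) (lift X) :=
  isSmoothField_prodField (hX.comp contMDiff_fst) contMDiff_const

theorem isSmoothField_dt : IsSmoothField (I.prod 𝓘(ℝ, ℝ)) (dt I (M := M)) :=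
  isSmoothField_prodField (isSmoothField_zero.comp contMDiff_fst) contMDiff_const

variable [FiniteDimensional ℝ E] [T2Space M]

theorem eq_zero_of_lift_of_dt {A : Type*} [AddCommGroup A] [Module ℝ A]
    {Φ : (∀ p : M × ℝ, TangentSpace (I.prod 𝓘(ℝ, ℝ)) p) → A}
    (hΦ : TensorialAt (I.prod 𝓘(ℝ, ℝ)) (E × ℝ) Φ p)
    (h_lift : ∀ X, IsSmoothField I X → Φ (lift X) = 0) (h_dt : Φ (dt I) = 0)
    {U : ∀ p : M × ℝ, TangentSpace (I.prod 𝓘(ℝ, ℝ)) p} (hU : MDiffAt (T% U) p) : Φ U = 0 := by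
  have : IsManifold (I.prod 𝓘(ℝ, ℝ)) 1 (M × ℝ) := inferInstance
  obtain ⟨X, hX, hX_eq⟩ := exists_isSmoothField_apply_eq p.1 (hor I p (U p))
  have lift_mdiffAt := (isSmoothField_lift hX).mdiffAt p
  have dt_mdiffAt := (isSmoothField_dt (I := I) (M := M)).mdiffAt p
  have const_mdiffAt : MDifferentiableAt (I.prod 𝓘(ℝ, ℝ)) 𝓘(ℝ, ℝ)
      (fun _ : M × ℝ ↦ ver I p (U p)) p := mdifferentiableAt_const
  have smul_dt_mdiffAt := const_mdiffAt.smul_section dt_mdiffAt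
  have U_apply_eq : U p = (lift X + (fun _ : M × ℝ ↦ ver I p (U p)) • dt I :
      ∀ q : M × ℝ, TangentSpace (I.prod 𝓘(ℝ, ℝ)) q) p := by
    refine hor_ver_ext ?_ ?_ <;> simp [hX_eq]
  rw [hΦ.pointwise hU (mdifferentiableAt_add_section lift_mdiffAt smul_dt_mdiffAt) U_apply_eq,
    hΦ.add lift_mdiffAt smul_dt_mdiffAt, hΦ.smul const_mdiffAt dt_mdiffAt, h_lift X hX, h_dt,
    smul_zero, add_zero]

theorem mlieBracket_lift_lift (hX : IsSmoothField I X) (hY : IsSmoothField I Y) (p : M × ℝ) :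
    mlieBracket (I.prod 𝓘(ℝ, ℝ)) (lift X) (lift Y) p = lift (mlieBracket I X Y) p := by
  refine hor_ver_ext (sub_eq_zero.1 (eq_zero_of_forall_mvfderiv_eq_zero fun f hf ↦ ?_)) ?_
  · have bracket_apply := mvfderiv_mlieBracket (isSmoothField_lift hX) (isSmoothField_lift hY)
      (f := fun q : M × ℝ ↦ f q.1) (hf.comp contMDiff_fst) p
    have hf_mdiff (x : M) := hf.mdifferentiableAt (x := x) (by simp)
    have hXf := (hX.mvfderiv hf).mdifferentiableAt (x := p.1) (by simp)
    have hYf := (hY.mvfderiv hf).mdifferentiableAt (x := p.1) (by simp)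
    simp only [mvfderiv_comp_fst (hf_mdiff _), hor_lift, mvfderiv_comp_fst hXf,
      mvfderiv_comp_fst hYf] at bracket_apply
    rw [map_sub, hor_lift, mvfderiv_mlieBracket hX hY hf, bracket_apply, sub_self]
  · have bracket_apply := mvfderiv_mlieBracket (isSmoothField_lift hX) (isSmoothField_lift hY)
      (f := fun q : M × ℝ ↦ q.2) contMDiff_snd p
    simpa only [mvfderiv_snd, ver_lift, mvfderiv_const, zero_apply, sub_zero] using bracket_apply

theorem mlieBracket_lift_dt (hX : IsSmoothField I X) (p : M × ℝ) :
    mlieBracket (I.prod 𝓘(ℝ, ℝ)) (lift X) (dt I) p = 0 := by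
  refine hor_ver_ext (eq_zero_of_forall_mvfderiv_eq_zero fun f hf ↦ ?_) ?_
  · have bracket_apply := mvfderiv_mlieBracket (isSmoothField_lift hX) isSmoothField_dt
      (f := fun q : M × ℝ ↦ f q.1) (hf.comp contMDiff_fst) p
    have hf_mdiff (x : M) := hf.mdifferentiableAt (x := x) (by simp)
    have hXf := (hX.mvfderiv hf).mdifferentiableAt (x := p.1) (by simp)
    simpa only [mvfderiv_comp_fst (hf_mdiff _), hor_lift, hor_dt, map_zero,
      mvfderiv_comp_fst hXf, mvfderiv_const, zero_apply, sub_zero] using bracket_apply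
  · have bracket_apply := mvfderiv_mlieBracket (isSmoothField_lift hX) isSmoothField_dt
      (f := fun q : M × ℝ ↦ q.2) contMDiff_snd p
    simpa only [mvfderiv_snd, ver_lift, ver_dt, mvfderiv_const, zero_apply, sub_zero, map_zero]
      using bracket_apply

theorem mlieBracket_dt_lift (hX : IsSmoothField I X) (p : M × ℝ) :
    mlieBracket (I.prod 𝓘(ℝ, ℝ)) (dt I) (lift X) p = 0 := by
  rw [mlieBracket_swap_apply, mlieBracket_lift_dt hX, neg_zero]

theorem mlieBracket_lift_add_smul_dt {f h : M → ℝ} (hX : IsSmoothField I X)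
    (hY : IsSmoothField I Y) (hf : MDifferentiableAt I 𝓘(ℝ, ℝ) f p.1)
    (hh : MDifferentiableAt I 𝓘(ℝ, ℝ) h p.1) :
    mlieBracket (I.prod 𝓘(ℝ, ℝ)) (lift X + (fun q : M × ℝ ↦ f q.1) • dt I)
        (lift Y + (fun q : M × ℝ ↦ h q.1) • dt I) p
      = lift (mlieBracket I X Y) p
        + (mvfderiv I h p.1 (X p.1) - mvfderiv I f p.1 (Y p.1)) • dt I p := by
  have : IsManifold (I.prod 𝓘(ℝ, ℝ)) 2 (M × ℝ) := inferInstance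
  have hX' := (isSmoothField_lift hX).mdiffAt p
  have hY' := (isSmoothField_lift hY).mdiffAt p
  have hdt := (isSmoothField_dt (I := I) (M := M)).mdiffAt p
  have hf' : MDifferentiableAt (I.prod 𝓘(ℝ, ℝ)) 𝓘(ℝ, ℝ) (fun q : M × ℝ ↦ f q.1) p :=
    hf.comp p mdifferentiableAt_fst
  have hh' : MDifferentiableAt (I.prod 𝓘(ℝ, ℝ)) 𝓘(ℝ, ℝ) (fun q : M × ℝ ↦ h q.1) p :=
    hh.comp p mdifferentiableAt_fst
  rw [mlieBracket_add_left hX' (hf'.smul_section hdt),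
    mlieBracket_add_right hY' (hh'.smul_section hdt),
    mlieBracket_add_right hY' (hh'.smul_section hdt),
    mlieBracket_smul_right hh' hdt, mlieBracket_smul_left hf' hdt, mlieBracket_smul_left hf' hdt,
    mlieBracket_smul_right hh' hdt, mlieBracket_lift_lift hX hY, mlieBracket_lift_dt hX,
    mlieBracket_dt_lift hY, mlieBracket_self]
  simp only [mvfderiv_comp_fst hf, mvfderiv_comp_fst hh, hor_lift, Pi.smul_apply', hor_dt,
    map_smul, map_zero, Pi.zero_apply, smul_zero]
  module

theorem mlieBracket_lift_add_smul_dt_lift {f : M → ℝ} (hX : IsSmoothField I X)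
    (hY : IsSmoothField I Y) (hf : MDifferentiableAt I 𝓘(ℝ, ℝ) f p.1) :
    mlieBracket (I.prod 𝓘(ℝ, ℝ)) (lift X + (fun q : M × ℝ ↦ f q.1) • dt I) (lift Y) p
      = lift (mlieBracket I X Y) p - mvfderiv I f p.1 (Y p.1) • dt I p := by
  have lift_eq : lift Y = lift Y + (fun _ : M × ℝ ↦ (0 : ℝ)) • dt I := by
    ext1 q
    simp
  rw [lift_eq, mlieBracket_lift_add_smul_dt hX hY hf (h := fun _ ↦ 0) mdifferentiableAt_const,
    mvfderiv_const]
  simp [sub_eq_add_neg]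

theorem mlieBracket_lift_lift_add_smul_dt {h : M → ℝ} (hX : IsSmoothField I X)
    (hY : IsSmoothField I Y) (hh : MDifferentiableAt I 𝓘(ℝ, ℝ) h p.1) :
    mlieBracket (I.prod 𝓘(ℝ, ℝ)) (lift X) (lift Y + (fun q : M × ℝ ↦ h q.1) • dt I) p
      = lift (mlieBracket I X Y) p + mvfderiv I h p.1 (X p.1) • dt I p := by
  have lift_eq : lift X = lift X + (fun _ : M × ℝ ↦ (0 : ℝ)) • dt I := by
    ext1 q
    simp
  rw [lift_eq, mlieBracket_lift_add_smul_dt hX hY (f := fun _ ↦ 0) mdifferentiableAt_const hh,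
    mvfderiv_const]
  simp

end Product

namespace AlmostContactMetric

local notation "𝕀[" n "]" => 𝓡 (2 * n + 1)

variable {n : ℕ} {M : Type*} [TopologicalSpace M]
  [ChartedSpace (EuclideanSpace ℝ (Fin (2 * n + 1))) M] [IsManifold 𝕀[n] ∞ M]

/-! ### Almost contact metric structures -/

section AlmostContact

variable (S : AlmostContactMetric n M) {X Y Z W : ∀ x : M, TangentSpace 𝕀[n] x} {x : M}

theorem inner_ξ_left (v : TangentSpace 𝕀[n] x) : S.g.inner x (S.ξ x) v = S.η x v :=
  (S.η_eq x v).symm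

theorem inner_ξ_right (v : TangentSpace 𝕀[n] x) : S.g.inner x v (S.ξ x) = S.η x v := by
  rw [S.g.symm, inner_ξ_left]

theorem inner_φ_left (v w : TangentSpace 𝕀[n] x) :
    S.g.inner x (S.φ x v) w = -S.g.inner x v (S.φ x w) := by
  have g_φ_φφ := S.g_φ_φ x v (S.φ x w)
  rw [S.φ_φ, S.η_φ, map_add, map_neg, map_smul, inner_ξ_right, S.η_φ, smul_zero, mul_zero,
    add_zero, sub_zero] at g_φ_φφ
  linarith

theorem φ_φ_φ (v : TangentSpace 𝕀[n] x) : S.φ x (S.φ x (S.φ x v)) = -S.φ x v := by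
  rw [S.φ_φ, S.η_φ, zero_smul, add_zero]

theorem φField_ξ : S.φField S.ξ = 0 :=
  funext S.φ_ξ

theorem φField_φField : S.φField (S.φField X) = -X + S.ηFun X • S.ξ :=
  funext fun y ↦ S.φ_φ y (X y)

theorem isSmoothField_φField (hX : IsSmoothField 𝕀[n] X) : IsSmoothField 𝕀[n] (S.φField X) :=
  ContMDiff.clm_bundle_apply S.smooth_φ hX

theorem mdiffAt_φField (hX : MDifferentiableAt 𝕀[n] 𝕀[n].tangent (T% X) x) :
    MDifferentiableAt 𝕀[n] 𝕀[n].tangent (T% (S.φField X)) x :=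
  MDifferentiableAt.clm_bundle_apply (S.smooth_φ.mdifferentiableAt (by simp)) hX

theorem ηFun_eq_inner : S.ηFun X = fun y ↦ S.g.inner y (S.ξ y) (X y) :=
  funext fun y ↦ S.η_eq y (X y)

theorem contMDiff_ηFun (hX : IsSmoothField 𝕀[n] X) : ContMDiff 𝕀[n] 𝓘(ℝ, ℝ) ∞ (S.ηFun X) := by
  rw [S.ηFun_eq_inner]
  exact S.smooth_ξ.inner S.g hX

theorem mdiffAt_ηFun (hX : MDifferentiableAt 𝕀[n] 𝕀[n].tangent (T% X) x) :
    MDifferentiableAt 𝕀[n] 𝓘(ℝ, ℝ) (S.ηFun X) x := by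
  rw [S.ηFun_eq_inner]
  exact mdiff_inner S.g (S.smooth_ξ.mdiffAt x) hX

theorem mvfderiv_ηFun (hX : MDifferentiableAt 𝕀[n] 𝕀[n].tangent (T% X) x)
    (v : TangentSpace 𝕀[n] x) :
    mvfderiv 𝕀[n] (S.ηFun X) x v
      = S.g.inner x (nabla S.g S.ξ x v) (X x) + S.η x (nabla S.g X x v) := by
  rw [S.ηFun_eq_inner, mvfderiv_inner S.g (S.smooth_ξ.mdiffAt x) hX, inner_ξ_left]

theorem η_nabla_ξ (v : TangentSpace 𝕀[n] x) : S.η x (nabla S.g S.ξ x v) = 0 := by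
  have deriv_ηFun_ξ := S.mvfderiv_ηFun (S.smooth_ξ.mdiffAt x) v
  have ηFun_ξ : S.ηFun S.ξ = fun _ ↦ 1 := funext S.η_ξ
  rw [ηFun_ξ, mvfderiv_const, zero_apply, inner_ξ_right] at deriv_ηFun_ξ
  linarith

theorem φ_φ_nabla_ξ (v : TangentSpace 𝕀[n] x) :
    S.φ x (S.φ x (nabla S.g S.ξ x v)) = -nabla S.g S.ξ x v := by
  rw [S.φ_φ, S.η_nabla_ξ, zero_smul, add_zero]

theorem two_mul_dForm_η : 2 * dForm 𝕀[n] S.η X Y x = mvfderiv 𝕀[n] (S.ηFun Y) x (X x)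
    - mvfderiv 𝕀[n] (S.ηFun X) x (Y x) - S.η x (mlieBracket 𝕀[n] X Y x) := by
  rw [dForm, ← mul_assoc, mul_one_div_cancel two_ne_zero, one_mul]
  rfl

theorem two_mul_dForm_η_eq_nabla_ξ (hX : MDifferentiableAt 𝕀[n] 𝕀[n].tangent (T% X) x)
    (hY : MDifferentiableAt 𝕀[n] 𝕀[n].tangent (T% Y) x) :
    2 * dForm 𝕀[n] S.η X Y x
      = S.g.inner x (nabla S.g S.ξ x (X x)) (Y x) - S.g.inner x (nabla S.g S.ξ x (Y x)) (X x) := by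
  rw [S.two_mul_dForm_η, ← nabla_sub_nabla S.g hX hY, map_sub, S.mvfderiv_ηFun hX,
    S.mvfderiv_ηFun hY]
  ring

theorem leviCivita_ξ (hX : MDifferentiableAt 𝕀[n] 𝕀[n].tangent (T% X) x) :
    leviCivita S.g X S.ξ x = nabla S.g S.ξ x (X x) :=
  leviCivita_eq_nabla S.g hX (S.smooth_ξ.mdiffAt x)

theorem nabla_φField_tensorialAt : TensorialAt 𝕀[n] (EuclideanSpace ℝ (Fin (2 * n + 1)))
    (fun X ↦ nabla S.g (S.φField X) x - S.φ x ∘L nabla S.g X x) x where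
  smul := by
    intro f X hf hX
    have φField_smul : S.φField (f • X) = f • S.φField X := by
      ext y; simp [φField]
    ext1 v
    simp only [sub_apply, smul_apply, ContinuousLinearMap.comp_apply]
    rw [φField_smul, nabla_smul S.g hf (S.mdiffAt_φField hX), nabla_smul S.g hf hX]
    simp only [map_add, map_smul, φField]
    module
  add := by
    intro X Y hX hY
    have φField_add : S.φField (X + Y) = S.φField X + S.φField Y := by
      ext y; simp [φField]
    ext1 v
    simp only [sub_apply, add_apply, ContinuousLinearMap.comp_apply]
    rw [φField_add, nabla_add S.g (S.mdiffAt_φField hX) (S.mdiffAt_φField hY),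
      nabla_add S.g hX hY, map_add]
    module

/-- The covariant derivative of `φ`: `covφ x w v = (∇_v φ) w`. -/
def covφ (x : M) : TangentSpace 𝕀[n] x →L[ℝ] TangentSpace 𝕀[n] x →L[ℝ] TangentSpace 𝕀[n] x :=
  have : IsManifold 𝕀[n] 1 M := inferInstance
  TensorialAt.mkHom _ x (S.nabla_φField_tensorialAt (x := x))

theorem nabla_φField (hX : MDifferentiableAt 𝕀[n] 𝕀[n].tangent (T% X) x)
    (v : TangentSpace 𝕀[n] x) :
    nabla S.g (S.φField X) x v = S.covφ x (X x) v + S.φ x (nabla S.g X x v) := by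
  have covφ_eq : S.covφ x (X x) = nabla S.g (S.φField X) x - S.φ x ∘L nabla S.g X x :=
    TensorialAt.mkHom_apply S.nabla_φField_tensorialAt hX
  simp [covφ_eq]

theorem inner_covφ (w u v : TangentSpace 𝕀[n] x) :
    S.g.inner x (S.covφ x w v) u = -S.g.inner x w (S.covφ x u v) := by
  obtain ⟨W, hW, rfl⟩ := exists_mdiffAt_apply_eq w
  obtain ⟨U, hU, rfl⟩ := exists_mdiffAt_apply_eq u
  have skew : (fun y ↦ S.g.inner y (S.φField W y) (U y))
      = -fun y ↦ S.g.inner y (W y) (S.φField U y) :=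
    funext fun y ↦ S.inner_φ_left (W y) (U y)
  have deriv := mvfderiv_inner S.g (S.mdiffAt_φField hW) hU v
  rw [skew, mvfderiv_neg, neg_apply, mvfderiv_inner S.g hW (S.mdiffAt_φField hU),
    S.nabla_φField hW, S.nabla_φField hU] at deriv
  simp only [φField, map_add, add_apply, S.inner_φ_left] at deriv
  linarith

theorem covφ_ξ (v : TangentSpace 𝕀[n] x) : S.covφ x (S.ξ x) v = -S.φ x (nabla S.g S.ξ x v) := by
  have nabla_φ_ξ := S.nabla_φField (S.smooth_ξ.mdiffAt x) v
  rw [S.φField_ξ, (nabla S.g).zero] at nabla_φ_ξ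
  exact eq_neg_of_add_eq_zero_left nabla_φ_ξ.symm

/- The covariant derivative of `φ² = -1 + η ⊗ ξ`. -/
theorem covφ_φ (w v : TangentSpace 𝕀[n] x) :
    S.covφ x (S.φ x w) v + S.φ x (S.covφ x w v)
      = S.g.inner x (nabla S.g S.ξ x v) w • S.ξ x + S.η x w • nabla S.g S.ξ x v := by
  obtain ⟨W, hW, rfl⟩ := exists_mdiffAt_apply_eq w
  have hξ := S.smooth_ξ.mdiffAt x
  have hη := S.mdiffAt_ηFun hW
  have nabla_φ_φ := S.nabla_φField (S.mdiffAt_φField hW) v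
  rw [S.φField_φField,
    nabla_add S.g (Y := -W) (mdifferentiableAt_neg_section hW) (hη.smul_section hξ),
    nabla_neg S.g hW, nabla_smul S.g hη hξ, S.nabla_φField hW, map_add, S.φ_φ,
    S.mvfderiv_ηFun hW] at nabla_φ_φ
  simp only [ηFun, φField] at nabla_φ_φ
  linear_combination (norm := module) -nabla_φ_φ

end AlmostContact

/-! ### Contact metric structures -/

/-- The condition `∇_v ξ = -φ v`, which characterizes the K-contact structures among the contact
metric structures. -/
def IsKContact (S : AlmostContactMetric n M) : Prop :=
  ∀ (x : M) (v : TangentSpace 𝕀[n] x), nabla S.g S.ξ x v = -S.φ x v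

namespace IsContactMetric

variable {S : AlmostContactMetric n M} {X Y : ∀ x : M, TangentSpace 𝕀[n] x} {x : M}

theorem mvfderiv_dForm_η (hS : S.IsContactMetric) (hX : IsSmoothField 𝕀[n] X)
    (hY : IsSmoothField 𝕀[n] Y) (v : TangentSpace 𝕀[n] x) :
    mvfderiv 𝕀[n] (dForm 𝕀[n] S.η X Y) x v = S.g.inner x (nabla S.g X x v) (S.φ x (Y x))
      - S.g.inner x (nabla S.g Y x v) (S.φ x (X x)) + S.g.inner x (X x) (S.covφ x (Y x) v) := by
  rw [funext (hS.2 X Y hX hY), mvfderiv_inner S.g (hX.mdiffAt x) (S.mdiffAt_φField (hY.mdiffAt x)),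
    S.nabla_φField (hY.mdiffAt x), map_add, S.g.symm x (nabla S.g Y x v), S.inner_φ_left, φField]
  ring

variable [T2Space M]

theorem inner_nabla_ξ_sub (hS : S.IsContactMetric) (v w : TangentSpace 𝕀[n] x) :
    S.g.inner x (nabla S.g S.ξ x v) w - S.g.inner x (nabla S.g S.ξ x w) v
      = 2 * S.g.inner x v (S.φ x w) := by
  obtain ⟨V, hV, rfl⟩ := exists_isSmoothField_apply_eq x v
  obtain ⟨W, hW, rfl⟩ := exists_isSmoothField_apply_eq x w
  rw [← S.two_mul_dForm_η_eq_nabla_ξ (hV.mdiffAt x) (hW.mdiffAt x), hS.2 V W hV hW]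
  rfl

theorem nabla_ξ_ξ (hS : S.IsContactMetric) (x : M) : nabla S.g S.ξ x (S.ξ x) = 0 := by
  refine eq_of_forall_inner_eq S.g fun w ↦ ?_
  have skew_part := hS.inner_nabla_ξ_sub (S.ξ x) w
  rw [S.inner_ξ_right, S.η_nabla_ξ, S.inner_ξ_left, S.η_φ] at skew_part
  rw [map_zero, zero_apply]
  linarith

/- `d(dη) = 0`, with `dη(X, Y) = g(X, φY)`. -/
theorem cyclic_sum_inner_covφ (hS : S.IsContactMetric) (u v w : TangentSpace 𝕀[n] x) :
    S.g.inner x u (S.covφ x v w) + S.g.inner x v (S.covφ x w u)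
      + S.g.inner x w (S.covφ x u v) = 0 := by
  obtain ⟨X, hX, rfl⟩ := exists_isSmoothField_apply_eq x u
  obtain ⟨Y, hY, rfl⟩ := exists_isSmoothField_apply_eq x v
  obtain ⟨Z, hZ, rfl⟩ := exists_isSmoothField_apply_eq x w
  have closed := cyclic_sum_mvfderiv_dForm (fun X hX ↦ S.contMDiff_ηFun hX) hX hY hZ x
  rw [hS.mvfderiv_dForm_η hY hZ, hS.mvfderiv_dForm_η hZ hX, hS.mvfderiv_dForm_η hX hY,
    hS.2 _ Z (hX.mlieBracket hY) hZ, hS.2 _ X (hY.mlieBracket hZ) hX,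
    hS.2 _ Y (hZ.mlieBracket hX) hY, ← nabla_sub_nabla S.g (hX.mdiffAt x) (hY.mdiffAt x),
    ← nabla_sub_nabla S.g (hY.mdiffAt x) (hZ.mdiffAt x),
    ← nabla_sub_nabla S.g (hZ.mdiffAt x) (hX.mdiffAt x)] at closed
  simp only [map_sub, sub_apply, φField] at closed
  linarith

theorem covφ_apply_ξ_eq (hS : S.IsContactMetric) (v : TangentSpace 𝕀[n] x) :
    S.covφ x v (S.ξ x) = -S.φ x (nabla S.g S.ξ x v) - nabla S.g S.ξ x (S.φ x v)
      - (2 : ℝ) • S.φ x (S.φ x v) := by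
  refine eq_of_forall_inner_eq S.g fun w ↦ ?_
  have cyclic := hS.cyclic_sum_inner_covφ (S.ξ x) v w
  have skew := S.inner_covφ (S.ξ x) v w
  rw [S.covφ_ξ, map_neg, neg_apply, S.inner_φ_left, neg_neg] at skew
  rw [S.covφ_ξ, S.g.symm x w, map_neg, neg_apply] at cyclic
  simp only [map_sub, map_neg, map_smul, sub_apply, neg_apply, smul_apply, smul_eq_mul]
  linarith [S.inner_covφ v w (S.ξ x), hS.inner_nabla_ξ_sub (S.φ x v) w,
    S.inner_φ_left (S.φ x v) w]

theorem covφ_apply_ξ (hS : S.IsContactMetric) (v : TangentSpace 𝕀[n] x) :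
    S.covφ x v (S.ξ x) = 0 := by
  have φ_covφ : S.φ x (S.covφ x v (S.ξ x)) = 0 := by
    have deriv_φ_φ := S.covφ_φ v (S.ξ x)
    rw [hS.nabla_ξ_ξ, hS.covφ_apply_ξ_eq, hS.covφ_apply_ξ_eq, S.φ_φ x v] at deriv_φ_φ
    rw [hS.covφ_apply_ξ_eq]
    simp only [map_zero, zero_apply, zero_smul, smul_zero, add_zero, map_add, map_sub, map_neg,
      map_smul, S.φ_φ_φ, S.φ_φ_nabla_ξ, S.φ_ξ, hS.nabla_ξ_ξ] at deriv_φ_φ ⊢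
    linear_combination (norm := module) (1 / 2 : ℝ) • deriv_φ_φ
  have η_covφ : S.η x (S.covφ x v (S.ξ x)) = 0 := by
    rw [hS.covφ_apply_ξ_eq]
    simp only [map_sub, map_neg, map_smul, S.η_φ, S.η_nabla_ξ, smul_zero, neg_zero, sub_zero]
  simpa [φ_covφ, η_covφ] using S.φ_φ x (S.covφ x v (S.ξ x))

theorem nabla_ξ_φ (hS : S.IsContactMetric) (v : TangentSpace 𝕀[n] x) :
    nabla S.g S.ξ x (S.φ x v)
      = -S.φ x (nabla S.g S.ξ x v) + (2 : ℝ) • v - (2 * S.η x v) • S.ξ x := by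
  have covφ_ξ_eq := hS.covφ_apply_ξ_eq v
  rw [hS.covφ_apply_ξ, S.φ_φ] at covφ_ξ_eq
  linear_combination (norm := module) covφ_ξ_eq

theorem nabla_φField_ξ (hS : S.IsContactMetric)
    (hX : MDifferentiableAt 𝕀[n] 𝕀[n].tangent (T% X) x) :
    nabla S.g (S.φField X) x (S.ξ x) = S.φ x (nabla S.g X x (S.ξ x)) := by
  rw [S.nabla_φField hX, hS.covφ_apply_ξ, zero_add]

/- A formula for `∇_X ξ` that only involves Lie brackets shows that it depends smoothly on the
base point. -/
theorem leviCivita_ξ_eq (hS : S.IsContactMetric) (hX : IsSmoothField 𝕀[n] X) :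
    leviCivita S.g X S.ξ = (-1 / 2 : ℝ) • S.φField (mlieBracket 𝕀[n] S.ξ (S.φField X)
      - S.φField (mlieBracket 𝕀[n] S.ξ X)) - S.φField X := by
  ext1 y
  have hξ := S.smooth_ξ.mdiffAt y
  simp only [Pi.smul_apply, Pi.sub_apply, φField]
  rw [leviCivita_eq_nabla S.g (hX.mdiffAt y) hξ, ← nabla_sub_nabla S.g hξ (hX.mdiffAt y),
    ← nabla_sub_nabla S.g hξ (S.mdiffAt_φField (hX.mdiffAt y)), hS.nabla_φField_ξ (hX.mdiffAt y),
    φField, hS.nabla_ξ_φ]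
  simp only [map_add, map_sub, map_smul, map_neg, S.φ_φ_nabla_ξ, S.φ_ξ]
  module

theorem isSmoothField_leviCivita_ξ (hS : S.IsContactMetric) (hX : IsSmoothField 𝕀[n] X) :
    IsSmoothField 𝕀[n] (leviCivita S.g X S.ξ) := by
  have hφX := S.isSmoothField_φField hX
  rw [hS.leviCivita_ξ_eq hX]
  exact ((S.isSmoothField_φField ((S.smooth_ξ.mlieBracket hφX).sub
    (S.isSmoothField_φField (S.smooth_ξ.mlieBracket hX)))).const_smul (-1 / 2 : ℝ)).sub hφX

theorem curvature_ξ (hS : S.IsContactMetric) (hX : IsSmoothField 𝕀[n] X)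
    (hY : IsSmoothField 𝕀[n] Y) :
    curvature S.g X Y S.ξ x = nabla S.g (leviCivita S.g Y S.ξ) x (X x)
      - nabla S.g (leviCivita S.g X S.ξ) x (Y x) - nabla S.g S.ξ x (mlieBracket 𝕀[n] X Y x) := by
  rw [curvature, S.leviCivita_ξ ((hX.mlieBracket hY).mdiffAt x),
    leviCivita_eq_nabla S.g (hX.mdiffAt x) ((hS.isSmoothField_leviCivita_ξ hY).mdiffAt x),
    leviCivita_eq_nabla S.g (hY.mdiffAt x) ((hS.isSmoothField_leviCivita_ξ hX).mdiffAt x)]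

theorem curvature_ξ_ξ (hS : S.IsContactMetric) (hX : IsSmoothField 𝕀[n] X) :
    curvature S.g S.ξ X S.ξ x = nabla S.g (leviCivita S.g X S.ξ) x (S.ξ x)
      - nabla S.g S.ξ x (nabla S.g X x (S.ξ x)) + nabla S.g S.ξ x (nabla S.g S.ξ x (X x)) := by
  have leviCivita_ξ_ξ : leviCivita S.g S.ξ S.ξ = 0 := by
    ext1 y
    rw [S.leviCivita_ξ (S.smooth_ξ.mdiffAt y), hS.nabla_ξ_ξ, Pi.zero_apply]
  rw [hS.curvature_ξ S.smooth_ξ hX, leviCivita_ξ_ξ, (nabla S.g).zero,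
    ← nabla_sub_nabla S.g (S.smooth_ξ.mdiffAt x) (hX.mdiffAt x), map_sub]
  simp only [Pi.zero_apply, zero_apply]
  abel

theorem leviCivita_φField_ξ (hS : S.IsContactMetric) (hX : IsSmoothField 𝕀[n] X) :
    leviCivita S.g (S.φField X) S.ξ
      = -S.φField (leviCivita S.g X S.ξ) + (2 : ℝ) • (X + -(S.ηFun X • S.ξ)) := by
  ext1 y
  simp only [Pi.add_apply, Pi.neg_apply, Pi.smul_apply, Pi.smul_apply', φField, ηFun]
  rw [S.leviCivita_ξ (hX.mdiffAt y), S.leviCivita_ξ (S.mdiffAt_φField (hX.mdiffAt y)), φField,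
    hS.nabla_ξ_φ]
  module

/- The second derivatives of `ξ` on the left cancel because `∇_ξ φ = 0` and `∇_ξ ξ = 0`. -/
theorem curvature_ξ_φField_ξ (hS : S.IsContactMetric) (hX : IsSmoothField 𝕀[n] X) :
    curvature S.g S.ξ (S.φField X) S.ξ x + S.φ x (curvature S.g S.ξ X S.ξ x)
      = (2 : ℝ) • S.φ x (nabla S.g S.ξ x (nabla S.g S.ξ x (X x))) := by
  have hB := hS.isSmoothField_leviCivita_ξ hX
  have hη := S.contMDiff_ηFun hX
  have hηξ := S.smooth_ξ.smul hη
  have nabla_leviCivita_φField_ξ : nabla S.g (leviCivita S.g (S.φField X) S.ξ) x (S.ξ x)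
      = -S.φ x (nabla S.g (leviCivita S.g X S.ξ) x (S.ξ x))
        + (2 : ℝ) • (nabla S.g X x (S.ξ x) - S.η x (nabla S.g X x (S.ξ x)) • S.ξ x) := by
    rw [hS.leviCivita_φField_ξ hX, nabla_add S.g ((S.isSmoothField_φField hB).neg.mdiffAt x)
        (((hX.add hηξ.neg).const_smul 2).mdiffAt x),
      nabla_neg S.g (S.mdiffAt_φField (hB.mdiffAt x)), hS.nabla_φField_ξ (hB.mdiffAt x),
      (nabla S.g).isCovariantDerivativeOn.smul_const _ ((hX.add hηξ.neg).mdiffAt x), smul_apply,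
      nabla_add S.g (hX.mdiffAt x) (hηξ.neg.mdiffAt x), nabla_neg S.g (hηξ.mdiffAt x),
      nabla_smul S.g (hη.mdifferentiableAt (by simp)) (S.smooth_ξ.mdiffAt x),
      S.mvfderiv_ηFun (hX.mdiffAt x), hS.nabla_ξ_ξ, map_zero, zero_apply]
    module
  rw [hS.curvature_ξ_ξ hX, hS.curvature_ξ_ξ (S.isSmoothField_φField hX), nabla_leviCivita_φField_ξ,
    hS.nabla_φField_ξ (hX.mdiffAt x)]
  simp only [φField, hS.nabla_ξ_φ, map_add, map_sub, map_smul, map_neg, hS.nabla_ξ_ξ, S.η_nabla_ξ]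
  module

theorem nabla_ξ_nabla_ξ (hS : S.IsContactMetric)
    (hR : ∀ Y : ∀ x : M, TangentSpace 𝕀[n] x, IsSmoothField 𝕀[n] Y →
      ∀ x, curvature S.g S.ξ Y S.ξ x = S.η x (Y x) • S.ξ x - Y x)
    (v : TangentSpace 𝕀[n] x) :
    nabla S.g S.ξ x (nabla S.g S.ξ x v) = S.η x v • S.ξ x - v := by
  obtain ⟨V, hV, rfl⟩ := exists_isSmoothField_apply_eq x v
  have R_φ := hS.curvature_ξ_φField_ξ (x := x) hV
  rw [hR _ hV, hR _ (S.isSmoothField_φField hV)] at R_φ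
  have φ_R_φ := congrArg (S.φ x) R_φ
  simp only [φField, S.η_φ, map_add, map_sub, map_smul, map_zero, smul_zero, S.φ_ξ,
    S.φ_φ_nabla_ξ, S.φ_φ] at φ_R_φ
  linear_combination (norm := module) (1 / 2 : ℝ) • φ_R_φ

/- `∇ξ + φ` is symmetric with square zero. -/
theorem isKContact (hS : S.IsContactMetric)
    (hR : ∀ Y : ∀ x : M, TangentSpace 𝕀[n] x, IsSmoothField 𝕀[n] Y →
      ∀ x, curvature S.g S.ξ Y S.ξ x = S.η x (Y x) • S.ξ x - Y x) :
    S.IsKContact := by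
  intro x v
  have sq_zero : nabla S.g S.ξ x (nabla S.g S.ξ x v + S.φ x v)
      + S.φ x (nabla S.g S.ξ x v + S.φ x v) = 0 := by
    rw [map_add, map_add, hS.nabla_ξ_nabla_ξ hR, hS.nabla_ξ_φ, S.φ_φ]
    module
  have symmetric (u w : TangentSpace 𝕀[n] x) : S.g.inner x (nabla S.g S.ξ x u + S.φ x u) w
      = S.g.inner x u (nabla S.g S.ξ x w + S.φ x w) := by
    simp only [map_add, add_apply]
    linarith [hS.inner_nabla_ξ_sub u w, S.inner_φ_left u w, S.g.symm x u (nabla S.g S.ξ x w)]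
  refine eq_neg_of_add_eq_zero_left (eq_zero_of_inner_self_eq_zero S.g ?_)
  rw [symmetric, sq_zero, map_zero]

end IsContactMetric

/-! ### The curvature identities -/

section CurvatureIdentities

variable {S : AlmostContactMetric n M} {X Y W : ∀ x : M, TangentSpace 𝕀[n] x} {x : M}

variable (S) in
/-- The case `Z = ξ` of the identity `(G₂)`. It also follows from the cases `Z = ξ` of `(G₁)` and
`(G₃)`, and it is all that the Sasakian condition requires of the curvature. -/
def SatisfiesGξ : Prop :=
  ∀ X Y W : ∀ x : M, TangentSpace 𝕀[n] x,
    IsSmoothField 𝕀[n] X → IsSmoothField 𝕀[n] Y → IsSmoothField 𝕀[n] W → ∀ x,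
      curvature₄ S.g X Y S.ξ W x - curvature₄ S.g (S.φField X) (S.φField Y) S.ξ W x
          - curvature₄ S.g (S.φField X) Y S.ξ (S.φField W) x
        = S.ηFun X x * (S.ηFun Y x * S.ηFun W x - S.gFun Y W x)

theorem curvature₄_φField_ξ (hX : IsSmoothField 𝕀[n] X) (hY : IsSmoothField 𝕀[n] Y) :
    curvature₄ S.g X Y (S.φField S.ξ) W x = 0 := by
  rw [S.φField_ξ, curvature₄, curvature_zero_right S.g hX hY, map_zero, zero_apply]

theorem satisfiesGξ_of_curvature₄_ξ
    (h : ∀ X Y W : ∀ x : M, TangentSpace 𝕀[n] x,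
      IsSmoothField 𝕀[n] X → IsSmoothField 𝕀[n] Y → IsSmoothField 𝕀[n] W → ∀ x,
        curvature₄ S.g X Y S.ξ W x = S.gFun X W x * S.ηFun Y x - S.gFun Y W x * S.ηFun X x) :
    S.SatisfiesGξ := by
  intro X Y W hX hY hW x
  have hφX := S.isSmoothField_φField hX
  rw [h X Y W hX hY hW, h _ _ W hφX (S.isSmoothField_φField hY) hW,
    h _ Y _ hφX hY (S.isSmoothField_φField hW)]
  simp only [gFun, ηFun, φField, S.η_φ, S.g_φ_φ]
  ring

theorem SatisfiesG₁.satisfiesGξ (h : S.SatisfiesG₁) : S.SatisfiesGξ := by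
  refine satisfiesGξ_of_curvature₄_ξ fun X Y W hX hY hW x ↦ ?_
  have hG := h X Y S.ξ W hX hY S.smooth_ξ hW x
  rw [curvature₄_φField_ξ hX hY] at hG
  simp only [gFun, ΦFun, φField, S.inner_ξ_right, S.η_φ] at hG
  simp only [gFun, ηFun]
  linarith

theorem SatisfiesG₂.satisfiesGξ (h : S.SatisfiesG₂) : S.SatisfiesGξ := by
  intro X Y W hX hY hW x
  have hG := h X Y S.ξ W hX hY S.smooth_ξ hW x
  rw [curvature₄_φField_ξ (S.isSmoothField_φField hX) hY] at hG
  simp only [gFun, ηFun, S.inner_ξ_right, S.η_ξ] at hG ⊢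
  linarith

theorem SatisfiesG₃.satisfiesGξ (h : S.SatisfiesG₃) : S.SatisfiesGξ := by
  refine satisfiesGξ_of_curvature₄_ξ fun X Y W hX hY hW x ↦ ?_
  have hG := h X Y S.ξ W hX hY S.smooth_ξ hW x
  rw [curvature₄_φField_ξ (S.isSmoothField_φField hX) (S.isSmoothField_φField hY)] at hG
  simp only [gFun, ηFun, S.inner_ξ_right, S.η_ξ] at hG ⊢
  linarith

variable [T2Space M]

theorem IsContactMetric.curvature₄_φField_ξ_left (hS : S.IsContactMetric)
    (hY : IsSmoothField 𝕀[n] Y) : curvature₄ S.g (S.φField S.ξ) Y S.ξ W x = 0 := by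
  have leviCivita_zero_ξ : leviCivita S.g 0 S.ξ = 0 := by
    ext1 y
    rw [S.leviCivita_ξ (isSmoothField_zero.mdiffAt y), Pi.zero_apply, map_zero]
  rw [S.φField_ξ, curvature₄, hS.curvature_ξ isSmoothField_zero hY, leviCivita_zero_ξ,
    (nabla S.g).zero]
  simp

theorem SatisfiesGξ.isKContact (h : S.SatisfiesGξ) (hS : S.IsContactMetric) : S.IsKContact := by
  refine hS.isKContact fun Y hY x ↦ eq_of_forall_inner_eq S.g fun w ↦ ?_
  obtain ⟨W, hW, rfl⟩ := exists_isSmoothField_apply_eq x w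
  have hG := h S.ξ Y W S.smooth_ξ hY hW x
  rw [hS.curvature₄_φField_ξ_left (S.isSmoothField_φField hY), hS.curvature₄_φField_ξ_left hY]
    at hG
  simpa [curvature₄, gFun, ηFun, S.η_ξ, S.inner_ξ_left] using hG

theorem IsKContact.curvature₄_ξ (hK : S.IsKContact) (hS : S.IsContactMetric)
    (hX : IsSmoothField 𝕀[n] X) (hY : IsSmoothField 𝕀[n] Y) :
    curvature₄ S.g X Y S.ξ W x = S.g.inner x (S.covφ x (X x) (W x)) (Y x) := by
  have leviCivita_ξ_eq_neg {Z : ∀ x : M, TangentSpace 𝕀[n] x} (hZ : IsSmoothField 𝕀[n] Z) :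
      leviCivita S.g Z S.ξ = -S.φField Z := by
    ext1 y
    rw [S.leviCivita_ξ (hZ.mdiffAt y), hK, Pi.neg_apply, φField]
  have hX' := hX.mdiffAt x
  have hY' := hY.mdiffAt x
  rw [curvature₄, hS.curvature_ξ hX hY, leviCivita_ξ_eq_neg hX, leviCivita_ξ_eq_neg hY,
    nabla_neg S.g (S.mdiffAt_φField hX'), nabla_neg S.g (S.mdiffAt_φField hY'),
    S.nabla_φField hX', S.nabla_φField hY', hK, ← nabla_sub_nabla S.g hX' hY']
  simp only [map_add, map_sub, map_neg, add_apply, sub_apply, neg_apply]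
  linarith [hS.cyclic_sum_inner_covφ (X x) (Y x) (W x), S.inner_covφ (Y x) (W x) (X x),
    S.inner_covφ (X x) (Y x) (W x), S.g.symm x (W x) (S.covφ x (X x) (Y x))]

/- `R(X, Y, ξ, W) = g((∇_W φ)X, Y)` turns the curvature identity into one for `∇φ`. -/
theorem SatisfiesGξ.covφ_sub (h : S.SatisfiesGξ) (hS : S.IsContactMetric)
    (w v : TangentSpace 𝕀[n] x) :
    S.covφ x w v + S.φ x (S.covφ x (S.φ x w) v) - S.covφ x (S.φ x w) (S.φ x v)
      = S.η x w • (S.η x v • S.ξ x - v) := by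
  refine eq_of_forall_inner_eq S.g fun u ↦ ?_
  obtain ⟨X, hX, rfl⟩ := exists_isSmoothField_apply_eq x w
  obtain ⟨W, hW, rfl⟩ := exists_isSmoothField_apply_eq x v
  obtain ⟨Y, hY, rfl⟩ := exists_isSmoothField_apply_eq x u
  have hK := h.isKContact hS
  have hφX := S.isSmoothField_φField hX
  have hG := h X Y W hX hY hW x
  rw [hK.curvature₄_ξ hS hX hY, hK.curvature₄_ξ hS hφX (S.isSmoothField_φField hY),
    hK.curvature₄_ξ hS hφX hY] at hG
  simp only [φField, gFun, ηFun, S.g.symm x (Y x)] at hG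
  simp only [map_add, map_sub, map_smul, add_apply, sub_apply, smul_apply, smul_eq_mul,
    S.inner_ξ_left, S.inner_φ_left]
  linarith

end CurvatureIdentities

/-! ### The Sasaki identity -/

section SasakiIdentity

/-- The identity `(∇_v φ)w = g(w, v)ξ - η(w)v`, which characterizes Sasakian structures among
almost contact metric structures. -/
def SatisfiesSasakiIdentity (S : AlmostContactMetric n M) : Prop :=
  ∀ (x : M) (w v : TangentSpace 𝕀[n] x),
    S.covφ x w v = S.g.inner x w v • S.ξ x - S.η x w • v

variable {S : AlmostContactMetric n M} {x : M}

variable (S) in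
/-- The bilinear map `(w, v) ↦ (∇_v φ)w - (g(w, v)ξ - η(w)v)`, whose vanishing is the Sasaki
identity. -/
def sasakiDefect (x : M) :
    TangentSpace 𝕀[n] x →ₗ[ℝ] TangentSpace 𝕀[n] x →ₗ[ℝ] TangentSpace 𝕀[n] x :=
  LinearMap.mk₂ ℝ (fun w v ↦ S.covφ x w v - (S.g.inner x w v • S.ξ x - S.η x w • v))
    (fun w w' v ↦ by simp only [map_add, add_apply]; module)
    (fun c w v ↦ by simp only [map_smul, smul_apply, smul_eq_mul]; module)
    (fun w v v' ↦ by simp only [map_add]; module)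
    (fun c w v ↦ by simp only [map_smul, smul_eq_mul]; module)

theorem sasakiDefect_apply (w v : TangentSpace 𝕀[n] x) : S.sasakiDefect x w v
    = S.covφ x w v - (S.g.inner x w v • S.ξ x - S.η x w • v) :=
  rfl

theorem IsKContact.sasakiDefect_φ_left (hK : S.IsKContact) (w v : TangentSpace 𝕀[n] x) :
    S.sasakiDefect x (S.φ x w) v = -S.φ x (S.sasakiDefect x w v) := by
  have deriv_φ_φ := S.covφ_φ w v
  rw [hK, map_neg, neg_apply, S.inner_φ_left, neg_neg, S.g.symm] at deriv_φ_φ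
  simp only [sasakiDefect_apply, map_sub, map_smul, S.η_φ, S.φ_ξ]
  linear_combination (norm := module) deriv_φ_φ

theorem IsKContact.sasakiDefect_ξ_left (hK : S.IsKContact) (v : TangentSpace 𝕀[n] x) :
    S.sasakiDefect x (S.ξ x) v = 0 := by
  rw [sasakiDefect_apply, S.covφ_ξ, hK, map_neg, S.φ_φ, S.inner_ξ_left, S.η_ξ]
  module

theorem IsKContact.sasakiDefect_φ_φ_left (hK : S.IsKContact) (w v : TangentSpace 𝕀[n] x) :
    S.sasakiDefect x (S.φ x (S.φ x w)) v = -S.sasakiDefect x w v := by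
  simp [S.φ_φ, hK.sasakiDefect_ξ_left]

variable [T2Space M]

theorem IsContactMetric.sasakiDefect_ξ_right (hS : S.IsContactMetric) (w : TangentSpace 𝕀[n] x) :
    S.sasakiDefect x w (S.ξ x) = 0 := by
  rw [sasakiDefect_apply, hS.covφ_apply_ξ, S.inner_ξ_right]
  module

theorem IsContactMetric.sasakiDefect_φ_φ_right (hS : S.IsContactMetric)
    (w v : TangentSpace 𝕀[n] x) :
    S.sasakiDefect x w (S.φ x (S.φ x v)) = -S.sasakiDefect x w v := by
  simp [S.φ_φ, hS.sasakiDefect_ξ_right]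

theorem SatisfiesGξ.sasakiDefect_φ_φ (h : S.SatisfiesGξ) (hS : S.IsContactMetric)
    (w v : TangentSpace 𝕀[n] x) :
    S.sasakiDefect x (S.φ x w) (S.φ x v) = (2 : ℝ) • S.sasakiDefect x w v := by
  have hK := h.isKContact hS
  have φ_defect : S.φ x (S.sasakiDefect x (S.φ x w) v) = S.sasakiDefect x w v := by
    rw [← neg_neg (S.φ x _), ← hK.sasakiDefect_φ_left, hK.sasakiDefect_φ_φ_left, neg_neg]
  have hG := h.covφ_sub hS w v
  simp only [sasakiDefect_apply, map_sub, map_smul, S.η_φ, S.φ_ξ, S.g_φ_φ] at φ_defect ⊢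
  linear_combination (norm := module) φ_defect - hG

theorem SatisfiesGξ.satisfiesSasakiIdentity (h : S.SatisfiesGξ) (hS : S.IsContactMetric) :
    S.SatisfiesSasakiIdentity := by
  intro x w v
  have four_smul : S.sasakiDefect x w v = (4 : ℝ) • S.sasakiDefect x w v := calc
    S.sasakiDefect x w v = S.sasakiDefect x (S.φ x (S.φ x w)) (S.φ x (S.φ x v)) := by
      rw [(h.isKContact hS).sasakiDefect_φ_φ_left, hS.sasakiDefect_φ_φ_right, neg_neg]
    _ = (2 : ℝ) • (2 : ℝ) • S.sasakiDefect x w v := by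
      rw [h.sasakiDefect_φ_φ hS, h.sasakiDefect_φ_φ hS]
    _ = (4 : ℝ) • S.sasakiDefect x w v := by module
  have defect_eq_zero : S.sasakiDefect x w v = 0 := by
    linear_combination (norm := module) (-1 / 3 : ℝ) • four_smul
  exact sub_eq_zero.1 defect_eq_zero

end SasakiIdentity

/-! ### Normality -/

section Normality

variable (S : AlmostContactMetric n M) {X Y : ∀ x : M, TangentSpace 𝕀[n] x} {x : M}
  {p : M × ℝ}

theorem hor_coneJ (v : TangentSpace (𝕀[n].prod 𝓘(ℝ, ℝ)) p) :
    hor 𝕀[n] p (S.coneJ p v) = S.φ p.1 (hor 𝕀[n] p v) + ver 𝕀[n] p v • S.ξ p.1 :=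
  rfl

theorem ver_coneJ (v : TangentSpace (𝕀[n].prod 𝓘(ℝ, ℝ)) p) :
    ver 𝕀[n] p (S.coneJ p v) = -S.η p.1 (hor 𝕀[n] p v) :=
  rfl

theorem coneJ_coneJ (v : TangentSpace (𝕀[n].prod 𝓘(ℝ, ℝ)) p) :
    S.coneJ p (S.coneJ p v) = -v := by
  refine hor_ver_ext ?_ ?_
  · simp only [hor_coneJ, ver_coneJ, map_add, map_smul, map_neg, S.φ_φ, S.φ_ξ]
    module
  · simp only [hor_coneJ, ver_coneJ, map_add, map_smul, map_neg, S.η_φ, S.η_ξ, smul_eq_mul]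
    ring

theorem coneJ_lift (X : ∀ x : M, TangentSpace 𝕀[n] x) :
    (fun q : M × ℝ ↦ S.coneJ q (lift X q))
      = lift (S.φField X) + (fun q : M × ℝ ↦ (-S.ηFun X) q.1) • dt 𝕀[n] := by
  ext1 q
  refine hor_ver_ext ?_ ?_
  · simp [hor_coneJ, φField]
  · simp [ver_coneJ, ηFun]

theorem coneJ_lift_neg_ξ : (fun q : M × ℝ ↦ S.coneJ q (lift (-S.ξ) q)) = dt 𝕀[n] := by
  ext1 q
  refine hor_ver_ext ?_ ?_
  · simp [hor_coneJ, S.φ_ξ]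
  · simp [ver_coneJ, S.η_ξ]

theorem coneJ_eq_add (U : ∀ p : M × ℝ, TangentSpace (𝕀[n].prod 𝓘(ℝ, ℝ)) p) :
    (fun q ↦ S.coneJ q (U q))
      = prodField (fun q ↦ S.φ q.1 (hor 𝕀[n] q (U q))) (fun q ↦ -S.η q.1 (hor 𝕀[n] q (U q)))
        + (fun q ↦ ver 𝕀[n] q (U q)) • lift S.ξ := by
  ext1 q
  refine hor_ver_ext ?_ ?_
  · simp [hor_coneJ]
  · simp [ver_coneJ]

theorem mdiffAt_coneJ (U : ∀ p : M × ℝ, TangentSpace (𝕀[n].prod 𝓘(ℝ, ℝ)) p)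
    (hU : MDifferentiableAt (𝕀[n].prod 𝓘(ℝ, ℝ)) (𝕀[n].prod 𝓘(ℝ, ℝ)).tangent (T% U) p) :
    MDifferentiableAt (𝕀[n].prod 𝓘(ℝ, ℝ)) (𝕀[n].prod 𝓘(ℝ, ℝ)).tangent
      (T% fun q ↦ S.coneJ q (U q)) p := by
  have φ_mdiffAt : MDifferentiableAt (𝕀[n].prod 𝓘(ℝ, ℝ)) 𝕀[n].tangent
      (fun q : M × ℝ ↦ (⟨q.1, S.φ q.1 (hor 𝕀[n] q (U q))⟩ : TangentBundle 𝕀[n] M)) p :=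
    MDifferentiableAt.clm_bundle_apply
      ((S.smooth_φ.mdifferentiableAt (by simp)).comp p mdifferentiableAt_fst)
      (mdifferentiableAt_hor hU)
  have η_section_mdiffAt : MDifferentiableAt (𝕀[n].prod 𝓘(ℝ, ℝ)) (𝕀[n].prod 𝓘(ℝ, ℝ))
      (fun q : M × ℝ ↦ TotalSpace.mk' ℝ (E := Bundle.Trivial M ℝ) q.1
        (S.η q.1 (hor 𝕀[n] q (U q)))) p :=
    MDifferentiableAt.clm_bundle_apply
      ((S.smooth_η.mdifferentiableAt (by simp)).comp p mdifferentiableAt_fst)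
      (mdifferentiableAt_hor hU)
  have η_mdiffAt : MDifferentiableAt (𝕀[n].prod 𝓘(ℝ, ℝ)) 𝓘(ℝ, ℝ)
      (fun q : M × ℝ ↦ S.η q.1 (hor 𝕀[n] q (U q))) p :=
    ((mdifferentiableAt_totalSpace ..).1 η_section_mdiffAt).2
  have sum_mdiffAt := mdifferentiableAt_add_section (mdiffAt_prodField φ_mdiffAt η_mdiffAt.neg)
    ((mdifferentiableAt_ver hU).smul_section ((isSmoothField_lift S.smooth_ξ).mdiffAt p))
  exact sum_mdiffAt.congr_of_eventuallyEq
    (.of_forall fun q ↦ congrArg (TotalSpace.mk' _ q) (congrFun (S.coneJ_eq_add U) q))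

theorem nijenhuis_φ :
    nijenhuis 𝕀[n] S.φ X Y x
      = S.φ x (S.φ x (mlieBracket 𝕀[n] X Y x)) + mlieBracket 𝕀[n] (S.φField X) (S.φField Y) x
        - S.φ x (mlieBracket 𝕀[n] (S.φField X) Y x) - S.φ x (mlieBracket 𝕀[n] X (S.φField Y) x) :=
  rfl

theorem nijenhuis_φ_eq_covφ (hX : MDifferentiableAt 𝕀[n] 𝕀[n].tangent (T% X) x)
    (hY : MDifferentiableAt 𝕀[n] 𝕀[n].tangent (T% Y) x) :
    nijenhuis 𝕀[n] S.φ X Y x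
      = S.covφ x (Y x) (S.φ x (X x)) - S.covφ x (X x) (S.φ x (Y x))
        + S.φ x (S.covφ x (X x) (Y x) - S.covφ x (Y x) (X x)) := by
  have hφX := S.mdiffAt_φField hX
  have hφY := S.mdiffAt_φField hY
  simp only [S.nijenhuis_φ, ← nabla_sub_nabla S.g hX hY, ← nabla_sub_nabla S.g hφX hφY,
    ← nabla_sub_nabla S.g hφX hY, ← nabla_sub_nabla S.g hX hφY, S.nabla_φField hX,
    S.nabla_φField hY, map_add, map_sub, φField]
  module

theorem η_mlieBracket_φField_add (hX : MDifferentiableAt 𝕀[n] 𝕀[n].tangent (T% X) x)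
    (hY : MDifferentiableAt 𝕀[n] 𝕀[n].tangent (T% Y) x) :
    S.η x (mlieBracket 𝕀[n] (S.φField X) Y x + mlieBracket 𝕀[n] X (S.φField Y) x)
      = mvfderiv 𝕀[n] (S.ηFun Y) x (S.φ x (X x)) - mvfderiv 𝕀[n] (S.ηFun X) x (S.φ x (Y x))
        - S.g.inner x (nabla S.g S.ξ x (S.φ x (X x))) (Y x)
        + S.g.inner x (nabla S.g S.ξ x (S.φ x (Y x))) (X x)
        - S.η x (S.covφ x (X x) (Y x)) + S.η x (S.covφ x (Y x) (X x)) := by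
  rw [← nabla_sub_nabla S.g (S.mdiffAt_φField hX) hY,
    ← nabla_sub_nabla S.g hX (S.mdiffAt_φField hY), S.mvfderiv_ηFun hX, S.mvfderiv_ηFun hY,
    S.nabla_φField hX, S.nabla_φField hY]
  simp only [map_add, map_sub, S.η_φ, φField]
  ring

variable {S}

namespace SatisfiesSasakiIdentity

theorem isKContact (h : S.SatisfiesSasakiIdentity) : S.IsKContact := by
  intro x v
  have φ_nabla_ξ := S.covφ_ξ v
  rw [h, S.inner_ξ_left, S.η_ξ, one_smul] at φ_nabla_ξ
  have φ_φ_nabla_ξ := congrArg (S.φ x) φ_nabla_ξ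
  rw [map_sub, map_smul, S.φ_ξ, map_neg, S.φ_φ_nabla_ξ] at φ_φ_nabla_ξ
  linear_combination (norm := module) -φ_φ_nabla_ξ

theorem nijenhuis_φ (h : S.SatisfiesSasakiIdentity)
    (hX : MDifferentiableAt 𝕀[n] 𝕀[n].tangent (T% X) x)
    (hY : MDifferentiableAt 𝕀[n] 𝕀[n].tangent (T% Y) x) :
    nijenhuis 𝕀[n] S.φ X Y x = -(2 * dForm 𝕀[n] S.η X Y x) • S.ξ x := by
  rw [S.nijenhuis_φ_eq_covφ hX hY,
    S.two_mul_dForm_η_eq_nabla_ξ hX hY]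
  simp only [h x, h.isKContact x, map_neg, neg_apply, map_sub, map_smul, S.φ_ξ,
    S.g.symm x (Y x) (X x), S.g.symm x (Y x) (S.φ x (X x)), S.g.symm x (X x) (S.φ x (Y x))]
  module

theorem η_mlieBracket_φField_add (h : S.SatisfiesSasakiIdentity)
    (hX : MDifferentiableAt 𝕀[n] 𝕀[n].tangent (T% X) x)
    (hY : MDifferentiableAt 𝕀[n] 𝕀[n].tangent (T% Y) x) :
    S.η x (mlieBracket 𝕀[n] (S.φField X) Y x + mlieBracket 𝕀[n] X (S.φField Y) x)
      = mvfderiv 𝕀[n] (S.ηFun Y) x (S.φ x (X x))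
        - mvfderiv 𝕀[n] (S.ηFun X) x (S.φ x (Y x)) := by
  rw [S.η_mlieBracket_φField_add hX hY]
  simp only [h x, h.isKContact x, map_neg, neg_apply, map_sub, map_smul, S.φ_φ, map_add, add_apply,
    smul_apply, smul_eq_mul, S.inner_ξ_left, S.g.symm x (Y x) (X x)]
  ring

end SatisfiesSasakiIdentity

variable (S) [T2Space M]

theorem nijenhuis_lift_lift (hX : IsSmoothField 𝕀[n] X) (hY : IsSmoothField 𝕀[n] Y)
    (p : M × ℝ) :
    nijenhuis (𝕀[n].prod 𝓘(ℝ, ℝ)) S.coneJ (lift X) (lift Y) p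
      = lift (fun x ↦ nijenhuis 𝕀[n] S.φ X Y x + (2 * dForm 𝕀[n] S.η X Y x) • S.ξ x) p
        + (S.η p.1 (mlieBracket 𝕀[n] (S.φField X) Y p.1 + mlieBracket 𝕀[n] X (S.φField Y) p.1)
            - mvfderiv 𝕀[n] (S.ηFun Y) p.1 (S.φ p.1 (X p.1))
            + mvfderiv 𝕀[n] (S.ηFun X) p.1 (S.φ p.1 (Y p.1))) • dt 𝕀[n] p := by
  have hφX := S.isSmoothField_φField hX
  have hφY := S.isSmoothField_φField hY
  have hηX := (S.mdiffAt_ηFun (hX.mdiffAt p.1)).neg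
  have hηY := (S.mdiffAt_ηFun (hY.mdiffAt p.1)).neg
  rw [nijenhuis, S.coneJ_lift, S.coneJ_lift, S.coneJ_coneJ, mlieBracket_lift_lift hX hY,
    mlieBracket_lift_add_smul_dt hφX hφY hηX hηY, mlieBracket_lift_add_smul_dt_lift hφX hY hηX,
    mlieBracket_lift_lift_add_smul_dt hX hφY hηY, mvfderiv_neg, mvfderiv_neg]
  refine hor_ver_ext ?_ ?_
  · simp only [map_add, map_sub, map_neg, map_smul, map_zero, hor_coneJ, hor_lift, hor_dt, ver_lift,
      ver_dt, neg_apply, S.nijenhuis_φ, S.two_mul_dForm_η, S.φ_φ]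
    module
  · simp only [map_add, map_sub, map_neg, map_smul, map_zero, ver_coneJ, hor_lift, hor_dt, ver_lift,
      ver_dt, neg_apply, φField, smul_eq_mul]
    ring

variable {S}

namespace SatisfiesSasakiIdentity

theorem nijenhuis_lift_lift (h : S.SatisfiesSasakiIdentity) (hX : IsSmoothField 𝕀[n] X)
    (hY : IsSmoothField 𝕀[n] Y) (p : M × ℝ) :
    nijenhuis (𝕀[n].prod 𝓘(ℝ, ℝ)) S.coneJ (lift X) (lift Y) p = 0 := by
  rw [S.nijenhuis_lift_lift hX hY, h.η_mlieBracket_φField_add (hX.mdiffAt _) (hY.mdiffAt _)]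
  refine hor_ver_ext ?_ ?_
  · simp [h.nijenhuis_φ (hX.mdiffAt _) (hY.mdiffAt _)]
  · simp

theorem nijenhuis_lift_dt (h : S.SatisfiesSasakiIdentity) (hX : IsSmoothField 𝕀[n] X)
    (p : M × ℝ) :
    nijenhuis (𝕀[n].prod 𝓘(ℝ, ℝ)) S.coneJ (lift X) (dt 𝕀[n]) p = 0 := by
  have neg_ξ_smooth : IsSmoothField 𝕀[n] (-S.ξ) := S.smooth_ξ.neg
  rw [← S.coneJ_lift_neg_ξ, nijenhuis_apply_right (fun _ ↦ S.coneJ_coneJ)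
    ((isSmoothField_lift neg_ξ_smooth).mdiffAt p), h.nijenhuis_lift_lift hX neg_ξ_smooth, map_zero,
    neg_zero]

theorem isNormal (h : S.SatisfiesSasakiIdentity) : S.IsNormal := by
  intro U V hU hV p
  refine eq_zero_of_lift_of_dt (nijenhuis_tensorialAt_left S.mdiffAt_coneJ) (fun X hX ↦ ?_) ?_
    (hU.mdiffAt p)
  · exact eq_zero_of_lift_of_dt (nijenhuis_tensorialAt_right S.mdiffAt_coneJ)
      (fun Y hY ↦ h.nijenhuis_lift_lift hX hY p) (h.nijenhuis_lift_dt hX p) (hV.mdiffAt p)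
  · refine eq_zero_of_lift_of_dt (nijenhuis_tensorialAt_right S.mdiffAt_coneJ)
      (fun Y hY ↦ ?_) nijenhuis_self (hV.mdiffAt p)
    rw [nijenhuis_swap, h.nijenhuis_lift_dt hY, neg_zero]

end SatisfiesSasakiIdentity

end Normality

end AlmostContactMetric

end ContactGeometry

end

theorem corollary2_general {n : ℕ} {M : Type*} [TopologicalSpace M] [T2Space M]
    [ChartedSpace (EuclideanSpace ℝ (Fin (2 * n + 1))) M] [IsManifold (𝓡 (2 * n + 1)) ∞ M]
    {S : ContactGeometry.AlmostContactMetric n M} (hS : S.IsContactMetric)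
    (hG : S.SatisfiesGξ) : S.IsSasakian :=
  ⟨hS, (hG.satisfiesSasakiIdentity hS).isNormal⟩

/-- A contact metric manifold that satisfies one of the identities `(G₁)`, `(G₂)`, `(G₃)` is
Sasakian. -/
theorem corollary2 (n : ℕ) (M : Type*) [TopologicalSpace M] [T2Space M]
    [SecondCountableTopology M] [ChartedSpace (EuclideanSpace ℝ (Fin (2 * n + 1))) M]
    [IsManifold (𝓡 (2 * n + 1)) ∞ M] (S : ContactGeometry.AlmostContactMetric n M)
    (hS : S.IsContactMetric) (hG : S.SatisfiesG₁ ∨ S.SatisfiesG₂ ∨ S.SatisfiesG₃) :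
    S.IsSasakian :=
  corollary2_general hS
    (hG.elim (·.satisfiesGξ) (·.elim (·.satisfiesGξ) (·.satisfiesGξ)))
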